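/- Let $d,n,m$ be positive integers and $\mathbb S=\{1,\dots,m\}$. Let $B$ be a $d$-dimensional standard Brownian motion on a probability space $(\Omega,\mathcal F,\mathbb P)$ and let $r$ be a right-continuous time-homogeneous Markov chain on $\mathbb S$, independent of $B$, with generator $\Gamma=(\gamma_{ij})$ ($\gamma_{ij}\ge 0$ for $i\ne j$, $\gamma_{ii}=-\sum_{j\ne i}\gamma_{ij}$) and $r(0)=\ell\in\mathbb S$. Let $x_0\in\mathbb R^n$, and let $f:\mathbb R^n\times\mathbb S\to\mathbb R^n$ and $g:\mathbb R^n\times\mathbb S\to\mathbb R^{n\times d}$ be locally Lipschitz: for every $N>0$ there is $C_N>0$ with $|f(x,i)-f(y,i)|\vee|g(x,i)-g(y,i)|\le C_N|x-y|$ for all $i\in\mathbb S$ and $|x|\vee|y|\le N$. Here $|\cdot|$ is the Euclidean norm of vectors, and $|A|=\sqrt{\mathrm{trace}(A^TA)}$ for matrices. **Assumption.** For some $\bar p>0$ and each $i\in\mathbb S$ there are a symmetric positive-definite $Q_i\in\mathbb R^{n\times n}$ and $\alpha_i\in\mathbb R$ such that $$\limsup_{|x|\to\infty}\frac{(1+x^TQ_ix)\,\psi(x,i)-(2-\bar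 p)\,|x^TQ_ig(x,i)|^2}{(x^TQ_ix)^2}\le\alpha_i,\qquad \psi(x,i)=2x^TQ_if(x,i)+\mathrm{trace}\big[g^T(x,i)Q_ig(x,i)\big].$$ **Scheme.** For each $i\in\mathbb S$ let $\varphi_i:[1,\infty)\to[0,\infty)$ satisfy $$\sup_{|x|\le u}\Big(\frac{|f(x,i)|}{1+|x|}\vee\frac{|g(x,i)|^2}{(1+|x|)^2}\Big)\le\varphi_i(u)\qquad\text{for all } u\ge 1,$$ where either $\varphi_i$ is strictly increasing and continuous with $\varphi_i(u)\to\infty$ as $u\to\infty$, with inverse function $\varphi_i^{-1}$, or $\varphi_i$ is constant, in which case $\varphi_i^{-1}:=+\infty$. Let $K>0$ and let $h:(0,1]\to[\max_i\varphi_i(|x_0|\vee1),\infty)$ be strictly decreasing with $\lim_{\Delta\to0}h(\Delta)=\infty$ and $\Delta^{1/2}h(\Delta)\le K$ for all $\Delta\in(0,1]$. For $\Delta\in(0,1]$ put $\pi_\Delta^i(x)=\big(|x|\wedge\varphi_i^{-1}(h(\Delta))\big)\frac{x}{|x|}$ (with $\frac{x}{|x|}=0$ for $x=0$), $t_k=k\Delta$,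 $r_k=r(t_k)$ and $$\tilde Y_0=x_0,\qquad Y_k=\pi_\Delta^{r_k}(\tilde Y_k),\qquad \tilde Y_{k+1}=Y_k+f(Y_k,r_k)\Delta+g(Y_k,r_k)\big(B(t_{k+1})-B(t_k)\big),\qquad k\ge0.$$ **Theorem.** Under the Assumption, for every $p\in(0,\bar p]$ and $T>0$ there is a constant $C>0$, independent of $k$ and $\Delta$, such that $$\sup_{0<\Delta\le1}\ \sup_{0\le k\Delta\le T}\mathbb E|Y_k|^p\le C.$$ -/

import Mathlib

open MeasureTheory ProbabilityTheory Filter Topology Set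
open scoped NNReal ENNReal Matrix

noncomputable section

namespace TruncatedEM

/-- `ℝⁿ` with the Euclidean norm. -/
abbrev Vec (n : ℕ) : Type := EuclideanSpace ℝ (Fin n)

/-- The trace norm `|A| = √(trace (Aᵀ A))` of a matrix. -/
def traceNorm {n d : ℕ} (A : Matrix (Fin n) (Fin d) ℝ) : ℝ :=
  Real.sqrt (Matrix.trace (Aᵀ * A))

/-- `xᵀ Q y`. -/
def quad {n : ℕ} (Q : Matrix (Fin n) (Fin n) ℝ) (x y : Vec n) : ℝ :=
  x.ofLp ⬝ᵥ (Q *ᵥ y.ofLp)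

/-- The row vector `xᵀ A`, as an element of `ℝᵈ` with its Euclidean norm. -/
def rowMul {n d : ℕ} (x : Vec n) (A : Matrix (Fin n) (Fin d) ℝ) : Vec d :=
  WithLp.toLp 2 (x.ofLp ᵥ* A)

/-- The column vector `A v`, as an element of `ℝⁿ`. -/
def colMul {n d : ℕ} (A : Matrix (Fin n) (Fin d) ℝ) (v : Vec d) : Vec n :=
  WithLp.toLp 2 (A *ᵥ v.ofLp)

/-! ### The driving processes -/

/-- A `d`-dimensional standard Brownian motion: the coordinates are independent real
Brownian motions. -/
structure IsBrownianMotion {Ω : Type*} [MeasurableSpace Ω] {d : ℕ}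
    (B : ℝ≥0 → Ω → Vec d) (P : Measure Ω) : Prop where
  measurable : ∀ t, Measurable (B t)
  coord : ∀ j : Fin d, IsBrownianReal (fun t ω ↦ B t ω j) P
  indep : iIndepFun (fun (j : Fin d) (ω : Ω) (t : ℝ≥0) ↦ B t ω j) P

/-- `Γ = (γ_ij)` is a matrix of transition rates: `γ_ij ≥ 0` for `i ≠ j`
and `γ_ii = -∑_{j ≠ i} γ_ij`. -/
structure IsRateMatrix {m : ℕ} (Γ : Matrix (Fin m) (Fin m) ℝ) : Prop where
  nonneg : ∀ i j, i ≠ j → 0 ≤ Γ i j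
  diag : ∀ i, Γ i i = -∑ j ∈ Finset.univ.erase i, Γ i j

/-- `p t` (`t ≥ 0`) is a semigroup of stochastic matrices with generator `Γ`, that is
`p_ij(δ) = γ_ij δ + o(δ)` for `i ≠ j` and `p_ii(δ) = 1 + γ_ii δ + o(δ)` as `δ ↓ 0`. -/
structure IsTransitionFunction {m : ℕ} (p : ℝ≥0 → Matrix (Fin m) (Fin m) ℝ)
    (Γ : Matrix (Fin m) (Fin m) ℝ) : Prop where
  nonneg : ∀ t i j, 0 ≤ p t i j
  row_sum : ∀ t i, ∑ j, p t i j = 1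
  zero : p 0 = 1
  add : ∀ s t, p (s + t) = p s * p t
  rate : ∀ i j,
    (fun δ : ℝ≥0 ↦ p δ i j - ((if i = j then 1 else 0) + Γ i j * (δ : ℝ)))
      =o[𝓝[>] (0 : ℝ≥0)] (fun δ : ℝ≥0 ↦ (δ : ℝ))

/-- A right-continuous (time-homogeneous) Markov chain with state space `{1, …, m}` and
generator `Γ`. The Markov property `ℙ(r(s+t) = j | r(u), u ≤ s) = p_{r(s) j}(t)` is stated by
integrating over the events of the past of `s`. -/
structure IsMarkovChain {Ω : Type*} [MeasurableSpace Ω] {m : ℕ}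
    (r : ℝ≥0 → Ω → Fin m) (Γ : Matrix (Fin m) (Fin m) ℝ) (P : Measure Ω) : Prop where
  measurable : ∀ t, Measurable (r t)
  rightCont : ∀ᵐ ω ∂P, ∀ t, ContinuousWithinAt (fun s ↦ r s ω) (Ici t) t
  markov : ∃ p : ℝ≥0 → Matrix (Fin m) (Fin m) ℝ, IsTransitionFunction p Γ ∧
    ∀ (s t : ℝ≥0) (A : Set Ω),
      MeasurableSet[⨆ u : Iic s, MeasurableSpace.comap (r u) inferInstance] A →
      ∀ i j : Fin m,
        P.real (A ∩ {ω | r s ω = i} ∩ {ω | r (s + t) ω = j}) =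
          P.real (A ∩ {ω | r s ω = i}) * p t i j

/-! ### Conditions on the coefficients -/

/-- `f` and `g` are locally Lipschitz continuous in `x`, uniformly in the state `i`. -/
def LocallyLipschitzCoeff {n d m : ℕ} (f : Vec n → Fin m → Vec n)
    (g : Vec n → Fin m → Matrix (Fin n) (Fin d) ℝ) : Prop :=
  ∀ N : ℝ, 0 < N → ∃ C : ℝ, 0 < C ∧ ∀ x y : Vec n, max ‖x‖ ‖y‖ ≤ N → ∀ i,
    max ‖f x i - f y i‖ (traceNorm (g x i - g y i)) ≤ C * ‖x - y‖

/-- `ψ(x, i) = 2 xᵀ Q_i f(x, i) + trace (gᵀ(x, i) Q_i g(x, i))`, with `Q = Q_i`. -/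
def psi {n d m : ℕ} (f : Vec n → Fin m → Vec n)
    (g : Vec n → Fin m → Matrix (Fin n) (Fin d) ℝ)
    (Q : Matrix (Fin n) (Fin n) ℝ) (x : Vec n) (i : Fin m) : ℝ :=
  2 * quad Q x (f x i) + Matrix.trace ((g x i)ᵀ * Q * g x i)

/-- The Khasminskii-type growth condition with exponent `pbar`. The upper limit as `|x| → ∞` is
taken in the extended reals. -/
def GrowthAssumption {n d m : ℕ} (f : Vec n → Fin m → Vec n)
    (g : Vec n → Fin m → Matrix (Fin n) (Fin d) ℝ) (pbar : ℝ) : Prop :=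
  0 < pbar ∧ ∀ i : Fin m, ∃ (Q : Matrix (Fin n) (Fin n) ℝ) (α : ℝ), Q.PosDef ∧
    limsup (fun x : Vec n ↦
      ((((1 + quad Q x x) * psi f g Q x i - (2 - pbar) * ‖rowMul x (Q * g x i)‖ ^ 2)
        / (quad Q x x) ^ 2 : ℝ) : EReal)) (Bornology.cobounded (Vec n)) ≤ (α : EReal)

/-! ### The truncated Euler-Maruyama scheme -/

/-- `φ` is constant on `[1, ∞)`. -/
def ConstFromOne (φ : ℝ → ℝ) : Prop := ∀ u, 1 ≤ u → φ u = φ 1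

/-- `φ : [1, ∞) → ℝ₊` is an admissible bound for the growth of `f(·, i)` and `g(·, i)`: it is
strictly increasing, continuous and tends to infinity (or else it is constant, which the growth
bound allows only for linearly growing coefficients), and
`sup_{|x| ≤ u} (|f(x, i)| / (1 + |x|) ∨ |g(x, i)|² / (1 + |x|)²) ≤ φ(u)` for `u ≥ 1`. -/
structure IsGrowthBound {n d m : ℕ} (f : Vec n → Fin m → Vec n)
    (g : Vec n → Fin m → Matrix (Fin n) (Fin d) ℝ) (i : Fin m) (φ : ℝ → ℝ) : Prop where
  nonneg : ∀ u, 1 ≤ u → 0 ≤ φ u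
  shape : (StrictMonoOn φ (Ici 1) ∧ ContinuousOn φ (Ici 1) ∧ Tendsto φ atTop atTop) ∨
    ConstFromOne φ
  bound : ∀ u, 1 ≤ u → ∀ x : Vec n, ‖x‖ ≤ u →
    max (‖f x i‖ / (1 + ‖x‖)) (traceNorm (g x i) ^ 2 / (1 + ‖x‖) ^ 2) ≤ φ u

/-- `h : (0, 1] → [max_i φ_i(|x₀| ∨ 1), ∞)` is strictly decreasing, tends to infinity at `0`, and
`Δ^{1/2} h(Δ) ≤ K` for all `Δ ∈ (0, 1]`. -/
structure IsStepFunction {n m : ℕ} (φ : Fin m → ℝ → ℝ) (x₀ : Vec n) (h : ℝ → ℝ) (K : ℝ) :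
    Prop where
  strictAnti : StrictAntiOn h (Ioc 0 1)
  lower : ∀ Δ ∈ Ioc (0 : ℝ) 1, ∀ i, φ i (max ‖x₀‖ 1) ≤ h Δ
  tendsto : Tendsto h (𝓝[>] 0) atTop
  upper : ∀ Δ ∈ Ioc (0 : ℝ) 1, Δ ^ (1 / 2 : ℝ) * h Δ ≤ K

open scoped Classical in
/-- `φ⁻¹(y)`, the value at `y` of the inverse of `φ : [1, ∞) → ℝ₊`, with the convention
`φ⁻¹(y) = ∞` for a constant `φ`. -/
def growthInv (φ : ℝ → ℝ) (y : ℝ) : ℝ≥0∞ :=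
  if ConstFromOne φ then ⊤ else ENNReal.ofReal (Function.invFunOn φ (Ici 1) y)

/-- The truncation `x ↦ (|x| ∧ ρ) x / |x|` at radius `ρ ∈ [0, ∞]`, where `x / |x| = 0`
for `x = 0`. -/
def truncate {n : ℕ} (ρ : ℝ≥0∞) (x : Vec n) : Vec n :=
  (min (ENNReal.ofReal ‖x‖) ρ).toReal • (‖x‖⁻¹ • x)

/-- The values `Ỹ_k` of the scheme before truncation, with `t_k = kΔ`, `r_k = r(t_k)`,
`Y_k = π_Δ^{r_k}(Ỹ_k)`, `Ỹ_0 = x₀` and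
`Ỹ_{k+1} = Y_k + f(Y_k, r_k) Δ + g(Y_k, r_k) (B(t_{k+1}) - B(t_k))`. -/
def preScheme {Ω : Type*} {n d m : ℕ} (f : Vec n → Fin m → Vec n)
    (g : Vec n → Fin m → Matrix (Fin n) (Fin d) ℝ) (φ : Fin m → ℝ → ℝ) (h : ℝ → ℝ)
    (x₀ : Vec n) (B : ℝ≥0 → Ω → Vec d) (r : ℝ≥0 → Ω → Fin m) (Δ : ℝ≥0) : ℕ → Ω → Vec n
  | 0, _ => x₀
  | k + 1, ω =>
    let i : Fin m := r (k * Δ) ω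
    let y : Vec n := truncate (growthInv (φ i) (h Δ)) (preScheme f g φ h x₀ B r Δ k ω)
    y + (Δ : ℝ) • f y i + colMul (g y i) (B ((k + 1 : ℕ) * Δ) ω - B (k * Δ) ω)

/-- The truncated Euler-Maruyama scheme `Y_k = π_Δ^{r_k}(Ỹ_k)`. -/
def scheme {Ω : Type*} {n d m : ℕ} (f : Vec n → Fin m → Vec n)
    (g : Vec n → Fin m → Matrix (Fin n) (Fin d) ℝ) (φ : Fin m → ℝ → ℝ) (h : ℝ → ℝ)
    (x₀ : Vec n) (B : ℝ≥0 → Ω → Vec d) (r : ℝ≥0 → Ω → Fin m) (Δ : ℝ≥0) (k : ℕ) (ω : Ω) :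
    Vec n :=
  truncate (growthInv (φ (r (k * Δ) ω)) (h Δ)) (preScheme f g φ h x₀ B r Δ k ω)

end TruncatedEM

end

/-! Put `q = pbar / 2` and `V_i(x) = (1 + xᵀ Q_i x) ^ q`. Up to constants `V_i` dominates `|x| ^ p`,
so it suffices to bound the mean of `V_{r_k}(Y_k)`. Three effects act on it in one step.

Euler step in a frozen state. Truncation gives `|f| ≤ H (1 + |y|)` and `|g|² ≤ H (1 + |y|)²` with `H
= h(Δ) ≤ K Δ^{-1/2}`. With `δ = Δ^{1/4}`, the drift increment has size `δ²` and the noise increment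
size `δ` relative to `1 + |y|`. An error of order `δ⁴` is `O(Δ)`, so a third-order Taylor expansion
of the power is enough. The terms of order `δ` and `δ³` are odd in the Gaussian increment and
average to zero. Those of order `δ²` form `Δ` times the generator applied to `V_i`, which the growth
assumption controls, plus a harmless `Δ² fᵀ Q_i f`. The mean of `V_i` thus grows by a factor of at
most `1 + C Δ` (`lintegral_step_le`).

Truncation. It is a radial contraction, so it increases no `V_i` (`lyapunov_truncate_le`).

Switching. All `V_i` are comparable, so a change of state costs a factor of at most `M`. A switch
has probability `O(Δ)` per step, and the mean of `M` to the number of switches is at most `(1 + C Δ)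
^ k` (`IsMarkovChain.exists_lintegral_switchWeight_le`).

By independence the path of the chain can be frozen while averaging over `B`, and then integrated
out (`lintegral_lyapunov_scheme_le`). Since `kΔ ≤ T`, the factors multiply to at most `exp (C T)`.
-/

namespace TruncatedEM

/-! ### Taylor bounds for real powers -/

/-- A third-order Taylor bound for `(1 + u) ^ q`, valid on all of `[-1, ∞)`. -/
lemma one_add_rpow_le_taylor {q : ℝ} (hq : 0 < q) :
    ∃ c C : ℝ, 0 ≤ C ∧ ∃ N : ℕ, 4 ≤ N ∧ ∀ u : ℝ, -1 ≤ u →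
      (1 + u) ^ q ≤ 1 + q * u + q * (q - 1) / 2 * u ^ 2 + c * u ^ 3 + C * (|u| ^ 4 + |u| ^ N) := by
  have hO := (Real.one_add_rpow_hasFPowerSeriesAt_zero (a := q)).isBigO_sub_partialSum_pow 4
  obtain ⟨c₁, hc₁⟩ := hO.bound
  obtain ⟨δ, hδ, hball⟩ := Metric.eventually_nhds_iff.1 hc₁
  set c := Ring.choose q 3
  have h2 : Ring.choose q 2 = q * (q - 1) / 2 := by
    rw [Ring.choose_eq_smul]
    simp [descPochhammer, Polynomial.smeval_mul, Nat.factorial]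
    ring
  set D : ℝ := 1 + |q| + |q * (q - 1) / 2| + |c| with hD
  obtain ⟨N₀, hN₀⟩ := exists_nat_ge q
  set N := max 4 N₀
  have hN : 4 ≤ N := le_max_left _ _
  have hqN : q ≤ N := hN₀.trans (by exact_mod_cast le_max_right _ _)
  have hD1 : 0 ≤ D := by positivity
  -- `|c₁|` serves `|u| < δ`, where the binomial series applies. For `|u| ≥ δ` each term is at most
  -- its coefficient times `(1 + |u|) ^ N`, as `N ≥ q` and `N ≥ 3`, and `1 + |u| ≤ (1 / δ + 1) |u|`.
  refine ⟨c, |c₁| + (1 + D) * (1 / δ + 1) ^ N, by positivity, N, hN, fun u hu ↦ ?_⟩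
  rcases lt_or_ge |u| δ with hlt | hge
  · have h := hball (y := u) (by simpa using hlt)
    simp only [FormalMultilinearSeries.partialSum, Finset.sum_range_succ, binomialSeries_apply,
      zero_add, Finset.range_zero, Finset.sum_empty, Ring.choose_zero_right,
      Ring.choose_one_right, h2] at h
    simp only [List.ofFn_const, List.prod_replicate, smul_eq_mul, Real.norm_eq_abs, abs_pow,
      abs_abs] at h
    have h' := (abs_le.1 h).2
    have e1 : c₁ * |u| ^ 4 ≤ |c₁| * |u| ^ 4 :=
      mul_le_mul_of_nonneg_right (le_abs_self _) (by positivity)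
    have e2 : 0 ≤ |c₁| * |u| ^ N := by positivity
    have e3 : 0 ≤ (1 + D) * (1 / δ + 1) ^ N * (|u| ^ 4 + |u| ^ N) := by positivity
    rw [add_mul, mul_add]
    simp only [pow_zero, pow_one] at h'
    change (1 + u) ^ q - (1 * 1 + q * u + q * (q - 1) / 2 * u ^ 2 + c * u ^ 3) ≤ _ at h'
    linarith
  · have hu0 : 0 ≤ |u| := abs_nonneg u
    have hb1 : 1 ≤ 1 + |u| := by linarith
    have hb : 1 + |u| ≤ (1 / δ + 1) * |u| := by
      have : 1 ≤ 1 / δ * |u| := by rw [one_div, inv_mul_eq_div]; exact (one_le_div hδ).2 hge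
      linarith
    have hpow : (1 + |u|) ^ N ≤ (1 / δ + 1) ^ N * |u| ^ N := by
      rw [← mul_pow]; exact pow_le_pow_left₀ (by positivity) hb N
    have k1 : (1 + u) ^ q ≤ (1 + |u|) ^ N := by
      calc (1 + u) ^ q ≤ (1 + |u|) ^ q :=
            Real.rpow_le_rpow (by linarith) (by linarith [le_abs_self u]) hq.le
        _ ≤ (1 + |u|) ^ (N : ℝ) := Real.rpow_le_rpow_of_exponent_le hb1 hqN
        _ = _ := Real.rpow_natCast _ _
    have m (j : ℕ) (hj : j ≤ N) (a : ℝ) : -(|a| * (1 + |u|) ^ N) ≤ a * u ^ j := by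
      have : |a * u ^ j| ≤ |a| * (1 + |u|) ^ N := by
        rw [abs_mul, abs_pow]
        refine mul_le_mul_of_nonneg_left ?_ (abs_nonneg a)
        exact (pow_le_pow_left₀ hu0 (by linarith) j).trans (pow_le_pow_right₀ hb1 hj)
      exact (abs_le.1 this).1
    have m1 := m 1 (by omega) q
    have m2 := m 2 (by omega) (q * (q - 1) / 2)
    have m3 := m 3 (by omega) c
    have m0 := one_le_pow₀ hb1 (n := N)
    have key : (1 + u) ^ q - (1 + q * u + q * (q - 1) / 2 * u ^ 2 + c * u ^ 3)
        ≤ (1 + D) * (1 + |u|) ^ N := by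
      rw [hD]; rw [pow_one] at m1; linarith
    have key2 : (1 + D) * (1 + |u|) ^ N ≤ (1 + D) * (1 / δ + 1) ^ N * |u| ^ N := by
      rw [mul_assoc]; exact mul_le_mul_of_nonneg_left hpow (by positivity)
    have e3 : 0 ≤ |c₁| * (|u| ^ 4 + |u| ^ N) := by positivity
    have e4 : 0 ≤ (1 + D) * (1 / δ + 1) ^ N * |u| ^ 4 := by positivity
    rw [add_mul, mul_add ((1 + D) * (1 / δ + 1) ^ N)]
    linarith

/-- Expansion of `(1 + s + w + v) ^ q` where `s`, `w`, `v` are of order `δ`, `δ²`, `δ³`, up to an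
error of order `δ⁴`. -/
lemma one_add_rpow_le_expansion {q : ℝ} (hq : 0 < q) {b : ℝ} (hb : 0 ≤ b) :
    ∃ c C : ℝ, 0 ≤ C ∧ ∃ N : ℕ, ∀ s w v δ τ : ℝ, 0 ≤ δ → δ ≤ 1 → 1 ≤ τ →
      |s| ≤ b * (δ * τ) → |w| ≤ b * (δ ^ 2 * τ) → |v| ≤ b * (δ ^ 3 * τ) → 0 ≤ 1 + (s + w + v) →
      (1 + (s + w + v)) ^ q ≤ 1 + q * (s + w + v) + q * (q - 1) / 2 * (s ^ 2 + 2 * (s * w))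
        + c * s ^ 3 + C * (δ ^ 4 * τ ^ N) := by
  obtain ⟨c, C, hC, N, hN, H⟩ := one_add_rpow_le_taylor hq
  -- The summands pay for dropping `2sv + (w + v)²` from the square, for replacing the cube by `s ^
  -- 3` (with `26 = 2 (9 + 3 + 1)`), and for the Taylor remainder, where `|s + w + v| ≤ 3bδτ`.
  refine ⟨c, |q * (q - 1) / 2| * (6 * b ^ 2) + |c| * (26 * b ^ 3)
    + C * ((3 * b) ^ 4 + (3 * b) ^ N), by positivity, N, ?_⟩
  intro s w v δ τ hδ hδ1 hτ hs hw hv hu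
  have hτ0 : 0 ≤ τ := by linarith
  have d2 : δ ^ 2 ≤ δ := by nlinarith
  have d3 : δ ^ 3 ≤ δ ^ 2 := by nlinarith [sq_nonneg δ]
  have hv2 : |v| ≤ b * (δ ^ 2 * τ) := hv.trans (by gcongr)
  have hw1 : |w| ≤ b * (δ * τ) := hw.trans (by gcongr)
  have hv1 : |v| ≤ b * (δ * τ) := hv2.trans (by gcongr)
  have hu1 : |s + w + v| ≤ 3 * b * (δ * τ) := by
    have := abs_add_le (s + w) v
    have := abs_add_le s w
    linarith
  have hwv : |w + v| ≤ 2 * b * (δ ^ 2 * τ) := by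
    have := abs_add_le w v
    linarith
  have hpw (j : ℕ) (hj : j ≤ N) : τ ^ j ≤ τ ^ N := pow_le_pow_right₀ hτ hj
  have hT := H (s + w + v) (by linarith)
  have b4 : |s + w + v| ^ 4 ≤ (3 * b) ^ 4 * (δ ^ 4 * τ ^ N) := by
    calc |s + w + v| ^ 4 ≤ (3 * b * (δ * τ)) ^ 4 := by gcongr
      _ = (3 * b) ^ 4 * (δ ^ 4 * τ ^ 4) := by ring
      _ ≤ _ := by have := hpw 4 hN; gcongr
  have bN : |s + w + v| ^ N ≤ (3 * b) ^ N * (δ ^ 4 * τ ^ N) := by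
    calc |s + w + v| ^ N ≤ (3 * b * (δ * τ)) ^ N := by gcongr
      _ = (3 * b) ^ N * (δ ^ N * τ ^ N) := by rw [mul_pow, mul_pow δ]
      _ ≤ _ := by have := pow_le_pow_of_le_one hδ hδ1 hN; gcongr
  have b2 : |(s + w + v) ^ 2 - (s ^ 2 + 2 * (s * w))| ≤ 6 * b ^ 2 * (δ ^ 4 * τ ^ N) := by
    have e : (s + w + v) ^ 2 - (s ^ 2 + 2 * (s * w)) = 2 * (s * v) + (w + v) * (w + v) := by ring
    have a1 : |s * v| ≤ b * (δ * τ) * (b * (δ ^ 3 * τ)) := by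
      rw [abs_mul]; gcongr
    have a2 : |(w + v) * (w + v)| ≤ 2 * b * (δ ^ 2 * τ) * (2 * b * (δ ^ 2 * τ)) := by
      rw [abs_mul]; gcongr
    calc _ ≤ 2 * |s * v| + |(w + v) * (w + v)| := by
            rw [e]; refine (abs_add_le _ _).trans ?_; rw [abs_mul]; norm_num
      _ ≤ 2 * (b * (δ * τ) * (b * (δ ^ 3 * τ)))
          + 2 * b * (δ ^ 2 * τ) * (2 * b * (δ ^ 2 * τ)) := by linarith
      _ = 6 * b ^ 2 * (δ ^ 4 * τ ^ 2) := by ring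
      _ ≤ _ := by have := hpw 2 (by omega); gcongr
  have b3 : |(s + w + v) ^ 3 - s ^ 3| ≤ 26 * b ^ 3 * (δ ^ 4 * τ ^ N) := by
    have e : (s + w + v) ^ 3 - s ^ 3 =
        (w + v) * ((s + w + v) * (s + w + v) + (s + w + v) * s + s * s) := by ring
    have a : |(s + w + v) * (s + w + v) + (s + w + v) * s + s * s|
        ≤ 3 * b * (δ * τ) * (3 * b * (δ * τ)) + 3 * b * (δ * τ) * (b * (δ * τ))
          + b * (δ * τ) * (b * (δ * τ)) := by
      refine (abs_add_three _ _ _).trans ?_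
      simp only [abs_mul]
      gcongr
    calc _ ≤ 2 * b * (δ ^ 2 * τ) * (3 * b * (δ * τ) * (3 * b * (δ * τ))
            + 3 * b * (δ * τ) * (b * (δ * τ)) + b * (δ * τ) * (b * (δ * τ))) := by
            rw [e, abs_mul]; gcongr
      _ = 26 * b ^ 3 * (δ ^ 4 * τ ^ 3) := by ring
      _ ≤ _ := by have := hpw 3 (by omega); gcongr
  have r2 : q * (q - 1) / 2 * ((s + w + v) ^ 2 - (s ^ 2 + 2 * (s * w)))
      ≤ |q * (q - 1) / 2| * (6 * b ^ 2 * (δ ^ 4 * τ ^ N)) := by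
    refine (le_abs_self _).trans ?_; rw [abs_mul]; gcongr
  have r3 : c * ((s + w + v) ^ 3 - s ^ 3) ≤ |c| * (26 * b ^ 3 * (δ ^ 4 * τ ^ N)) := by
    refine (le_abs_self _).trans ?_; rw [abs_mul]; gcongr
  have r4 : C * (|s + w + v| ^ 4 + |s + w + v| ^ N)
      ≤ C * ((3 * b) ^ 4 * (δ ^ 4 * τ ^ N) + (3 * b) ^ N * (δ ^ 4 * τ ^ N)) := by gcongr
  linarith

end TruncatedEM

/-! ### Quadratic forms and matrix norms -/

namespace TruncatedEM

variable {n d m : ℕ}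

lemma quad_add_left (Q : Matrix (Fin n) (Fin n) ℝ) (x y z : Vec n) :
    quad Q (x + y) z = quad Q x z + quad Q y z := by
  simp [quad, add_dotProduct]

lemma quad_add_right (Q : Matrix (Fin n) (Fin n) ℝ) (x y z : Vec n) :
    quad Q x (y + z) = quad Q x y + quad Q x z := by
  simp [quad, Matrix.mulVec_add, dotProduct_add]

lemma quad_smul_left (Q : Matrix (Fin n) (Fin n) ℝ) (a : ℝ) (x y : Vec n) :
    quad Q (a • x) y = a * quad Q x y := by
  simp [quad, smul_dotProduct]

lemma quad_smul_right (Q : Matrix (Fin n) (Fin n) ℝ) (a : ℝ) (x y : Vec n) :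
    quad Q x (a • y) = a * quad Q x y := by
  simp [quad, Matrix.mulVec_smul, dotProduct_smul]

lemma quad_comm {Q : Matrix (Fin n) (Fin n) ℝ} (hQ : Qᵀ = Q) (x y : Vec n) :
    quad Q x y = quad Q y x := by
  rw [quad, quad, Matrix.dotProduct_mulVec, dotProduct_comm, ← Matrix.mulVec_transpose, hQ]

lemma quad_add_self {Q : Matrix (Fin n) (Fin n) ℝ} (hQ : Qᵀ = Q) (x y : Vec n) :
    quad Q (x + y) (x + y) = quad Q x x + 2 * quad Q x y + quad Q y y := by
  rw [quad_add_left, quad_add_right, quad_add_right, quad_comm hQ y x]; ring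

lemma quad_eq_inner (Q : Matrix (Fin n) (Fin n) ℝ) (x y : Vec n) :
    quad Q x y = inner ℝ x (Matrix.toEuclideanCLM (𝕜 := ℝ) Q y) := by
  simp [quad, EuclideanSpace.inner_eq_star_dotProduct, dotProduct_comm]

lemma continuous_quad (Q : Matrix (Fin n) (Fin n) ℝ) :
    Continuous fun x : Vec n ↦ quad Q x x := by
  simp_rw [quad_eq_inner]; fun_prop

lemma abs_quad_le (Q : Matrix (Fin n) (Fin n) ℝ) (x y : Vec n) :
    |quad Q x y| ≤ ‖Matrix.toEuclideanCLM (𝕜 := ℝ) Q‖ * (‖x‖ * ‖y‖) := by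
  rw [quad_eq_inner]
  refine (abs_real_inner_le_norm _ _).trans ?_
  have := (Matrix.toEuclideanCLM (𝕜 := ℝ) Q).le_opNorm y
  have := mul_le_mul_of_nonneg_left this (norm_nonneg x)
  linarith

lemma quad_self_pos {Q : Matrix (Fin n) (Fin n) ℝ} (hQ : Q.PosDef) {x : Vec n} (hx : x ≠ 0) :
    0 < quad Q x x := by
  have := hQ.dotProduct_mulVec_pos (x := x.ofLp) (by simpa using hx)
  simpa [quad] using this

lemma quad_self_nonneg {Q : Matrix (Fin n) (Fin n) ℝ} (hQ : Q.PosDef) (x : Vec n) :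
    0 ≤ quad Q x x := by
  rcases eq_or_ne x 0 with rfl | hx
  · simp [quad]
  · exact (quad_self_pos hQ hx).le

/-- Compactness of the unit sphere and homogeneity; an empty sphere (`n = 0`) does no harm. -/
lemma exists_mul_norm_sq_le_quad {Q : Matrix (Fin n) (Fin n) ℝ} (hQ : Q.PosDef) :
    ∃ c : ℝ, 0 < c ∧ ∀ x : Vec n, c * ‖x‖ ^ 2 ≤ quad Q x x := by
  have hpos : ∀ x ∈ Metric.sphere (0 : Vec n) 1, 0 < quad Q x x := by
    intro x hx
    refine quad_self_pos hQ ?_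
    rintro rfl
    simp at hx
  obtain ⟨c, hc, H⟩ := (isCompact_sphere (0 : Vec n) 1).exists_forall_le'
    (continuous_quad Q).continuousOn hpos
  refine ⟨c, hc, fun x ↦ ?_⟩
  rcases eq_or_ne x 0 with rfl | hx
  · simp [quad]
  have hx' : ‖x‖ ≠ 0 := norm_ne_zero_iff.2 hx
  have h := H (‖x‖⁻¹ • x) (by simp [norm_smul, hx'])
  rw [quad_smul_left, quad_smul_right] at h
  have := mul_le_mul_of_nonneg_right h (sq_nonneg ‖x‖)
  refine this.trans (le_of_eq ?_)
  field_simp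

lemma traceNorm_sq (A : Matrix (Fin n) (Fin d) ℝ) : traceNorm A ^ 2 = ∑ i, ∑ j, A i j ^ 2 := by
  have h : Matrix.trace (Aᵀ * A) = ∑ i, ∑ j, A i j ^ 2 := by
    rw [Finset.sum_comm]
    simp [Matrix.trace, Matrix.mul_apply, sq]
  rw [traceNorm, h, Real.sq_sqrt (by positivity)]

lemma traceNorm_nonneg (A : Matrix (Fin n) (Fin d) ℝ) : 0 ≤ traceNorm A := Real.sqrt_nonneg _

lemma norm_colMul_le (A : Matrix (Fin n) (Fin d) ℝ) (z : Vec d) :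
    ‖colMul A z‖ ≤ traceNorm A * ‖z‖ := by
  refine le_of_sq_le_sq ?_ (mul_nonneg (traceNorm_nonneg A) (norm_nonneg z))
  rw [mul_pow, traceNorm_sq, EuclideanSpace.real_norm_sq_eq, EuclideanSpace.real_norm_sq_eq,
    Finset.sum_mul]
  refine Finset.sum_le_sum fun i _ ↦ ?_
  simpa [colMul, Matrix.mulVec, dotProduct] using
    Finset.sum_mul_sq_le_sq_mul_sq Finset.univ (A i) z.ofLp

lemma colMul_smul (A : Matrix (Fin n) (Fin d) ℝ) (a : ℝ) (z : Vec d) :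
    colMul A (a • z) = a • colMul A z := by
  simp [colMul, Matrix.mulVec_smul]

lemma colMul_neg (A : Matrix (Fin n) (Fin d) ℝ) (z : Vec d) : colMul A (-z) = -colMul A z := by
  simpa using colMul_smul A (-1) z

/-- Exhibits the first-order noise term as a Gaussian linear form, whose variance is the `|xᵀ Q g|²`
of the growth assumption. -/
lemma quad_colMul_right (Q : Matrix (Fin n) (Fin n) ℝ) (A : Matrix (Fin n) (Fin d) ℝ)
    (y : Vec n) (z : Vec d) : quad Q y (colMul A z) = inner ℝ (rowMul y (Q * A)) z := by
  simp [quad, colMul, rowMul, EuclideanSpace.inner_eq_star_dotProduct, ← Matrix.dotProduct_mulVec,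
    dotProduct_comm z.ofLp, Matrix.mulVec_mulVec]

lemma quad_colMul_self (Q : Matrix (Fin n) (Fin n) ℝ) (A : Matrix (Fin n) (Fin d) ℝ) (z : Vec d) :
    quad Q (colMul A z) (colMul A z) = ∑ j, ∑ k, (Aᵀ * Q * A) j k * (z j * z k) := by
  have : quad Q (colMul A z) (colMul A z) = z.ofLp ⬝ᵥ ((Aᵀ * Q * A) *ᵥ z.ofLp) := by
    simp only [quad, colMul]
    rw [← Matrix.mulVec_mulVec, ← Matrix.mulVec_mulVec, Matrix.dotProduct_mulVec z.ofLp,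
      Matrix.vecMul_transpose]
  rw [this]
  simp only [dotProduct, Matrix.mulVec, Finset.mul_sum]
  refine Finset.sum_congr rfl fun j _ ↦ Finset.sum_congr rfl fun k _ ↦ by ring

/-! ### Moments of the standard Gaussian measure -/

lemma integrable_one_add_norm_pow_stdGaussian (N : ℕ) :
    Integrable (fun z : Vec d ↦ (1 + ‖z‖) ^ N) (stdGaussian (Vec d)) := by
  have h : MemLp (fun z : Vec d ↦ (1 : ℝ) + ‖z‖) N (stdGaussian (Vec d)) :=
    MemLp.add (memLp_const (1 : ℝ))
      (IsGaussian.memLp_id (stdGaussian (Vec d)) (N : ℝ≥0∞) (by simp)).norm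
  have := h.integrable_norm_pow'
  refine this.congr (ae_of_all _ fun z ↦ ?_)
  simp only [Real.norm_eq_abs]
  rw [abs_of_nonneg (by positivity)]

lemma map_neg_stdGaussian : (stdGaussian (Vec d)).map (fun z ↦ -z) = stdGaussian (Vec d) :=
  stdGaussian_map (LinearIsometryEquiv.neg ℝ (E := Vec d))

/-- The Gaussian law is invariant under `z ↦ -z`. Integrability is not needed, since the change of
variables holds for the Bochner integral in any case. -/
lemma integral_eq_zero_of_odd_stdGaussian {F : Vec d → ℝ} (hF : ∀ z, F (-z) = -F z) :
    ∫ z, F z ∂(stdGaussian (Vec d)) = 0 := by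
  have h : ∫ z, F (-z) ∂(stdGaussian (Vec d)) = ∫ z, F z ∂(stdGaussian (Vec d)) := by
    conv_rhs => rw [← map_neg_stdGaussian]
    exact (integral_map_equiv (MeasurableEquiv.neg (Vec d)) F).symm
  simp_rw [hF, integral_neg] at h
  linarith

lemma integral_inner_mul_inner_stdGaussian (a b : Vec d) :
    ∫ z, inner ℝ a z * inner ℝ b z ∂(stdGaussian (Vec d)) = inner ℝ a b := by
  have h1 := covarianceBilin_apply_eq_cov
    (IsGaussian.memLp_id (stdGaussian (Vec d)) 2 (by simp)) a b
  rw [covarianceBilin_stdGaussian, covariance] at h1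
  have h0 (c : Vec d) : ∫ z, inner ℝ c z ∂(stdGaussian (Vec d)) = 0 :=
    integral_eq_zero_of_odd_stdGaussian fun z ↦ by simp
  simp only [h0, sub_zero] at h1
  exact h1.symm

lemma integral_inner_sq_stdGaussian (a : Vec d) :
    ∫ z, (inner ℝ a z) ^ 2 ∂(stdGaussian (Vec d)) = ‖a‖ ^ 2 := by
  rw [← real_inner_self_eq_norm_sq, ← integral_inner_mul_inner_stdGaussian]
  simp_rw [sq]

lemma integrable_of_le_one_add_norm_pow {F : Vec d → ℝ} (hF : Continuous F) (c : ℝ) (N : ℕ)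
    (h : ∀ z, |F z| ≤ c * (1 + ‖z‖) ^ N) : Integrable F (stdGaussian (Vec d)) :=
  ((integrable_one_add_norm_pow_stdGaussian N).const_mul c).mono' hF.aestronglyMeasurable
    (ae_of_all _ h)

lemma integral_quad_colMul_stdGaussian (Q : Matrix (Fin n) (Fin n) ℝ)
    (A : Matrix (Fin n) (Fin d) ℝ) :
    ∫ z, quad Q (colMul A z) (colMul A z) ∂(stdGaussian (Vec d)) = Matrix.trace (Aᵀ * Q * A) := by
  have hint (j k : Fin d) : Integrable (fun z : Vec d ↦ z j * z k) (stdGaussian (Vec d)) := by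
    refine integrable_of_le_one_add_norm_pow (by fun_prop) 1 2 fun z ↦ ?_
    have hj := PiLp.norm_apply_le z j
    have hk := PiLp.norm_apply_le z k
    rw [Real.norm_eq_abs] at hj hk
    rw [abs_mul]
    have := mul_le_mul hj hk (abs_nonneg _) (norm_nonneg z)
    nlinarith [norm_nonneg z]
  have hval (j k : Fin d) :
      ∫ z : Vec d, z j * z k ∂(stdGaussian (Vec d)) = if j = k then 1 else 0 := by
    have := integral_inner_mul_inner_stdGaussian (EuclideanSpace.single j (1 : ℝ))
      (EuclideanSpace.single k (1 : ℝ))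
    simpa [EuclideanSpace.inner_single_left, eq_comm] using this
  simp_rw [quad_colMul_self]
  generalize Aᵀ * Q * A = S
  have hsum (j : Fin d) : ∫ z : Vec d, ∑ k, S j k * (z j * z k) ∂(stdGaussian (Vec d)) = S j j := by
    rw [integral_finsetSum _ fun k _ ↦ (hint j k).const_mul _]
    simp_rw [integral_const_mul, hval]
    simp
  have hint' (j : Fin d) :
      Integrable (fun z : Vec d ↦ ∑ k, S j k * (z j * z k)) (stdGaussian (Vec d)) :=
    integrable_finsetSum _ fun k _ ↦ (hint j k).const_mul _
  rw [integral_finsetSum _ fun j _ ↦ hint' j]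
  simp_rw [hsum]
  rfl

end TruncatedEM

/-! ### One Euler-Maruyama step in a frozen state -/

namespace TruncatedEM

variable {n d m : ℕ}

/-- Gaussian average of `(1 + s + w + v) ^ q` for odd `s`, `v` and even `w` of order `δ`, `δ³` and
`δ²`, up to an error of order `δ⁴`. -/
lemma lintegral_one_add_rpow_le {q : ℝ} (hq : 0 < q) {b : ℝ} (hb : 0 ≤ b) (d : ℕ) :
    ∃ C : ℝ, 0 ≤ C ∧ ∀ (s w v : Vec d → ℝ) (δ : ℝ), 0 ≤ δ → δ ≤ 1 →
      Continuous s → Continuous w → Continuous v →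
      (∀ z, s (-z) = -s z) → (∀ z, w (-z) = w z) → (∀ z, v (-z) = -v z) →
      (∀ z, |s z| ≤ b * (δ * (1 + ‖z‖) ^ 2)) → (∀ z, |w z| ≤ b * (δ ^ 2 * (1 + ‖z‖) ^ 2)) →
      (∀ z, |v z| ≤ b * (δ ^ 3 * (1 + ‖z‖) ^ 2)) → (∀ z, 0 ≤ 1 + (s z + w z + v z)) →
      ∫⁻ z, ENNReal.ofReal ((1 + (s z + w z + v z)) ^ q) ∂(stdGaussian (Vec d)) ≤
        ENNReal.ofReal (1 + q * ∫ z, w z ∂(stdGaussian (Vec d))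
          + q * (q - 1) / 2 * ∫ z, s z ^ 2 ∂(stdGaussian (Vec d)) + C * δ ^ 4) := by
  obtain ⟨c, C, hC, N, H⟩ := one_add_rpow_le_expansion hq hb
  set γ := stdGaussian (Vec d) with hγ
  -- The expansion is used with `τ = (1 + ‖z‖) ^ 2`, so its error carries the Gaussian moment of
  -- order `2 * N`.
  refine ⟨C * ∫ z : Vec d, (1 + ‖z‖) ^ (2 * N) ∂γ,
    mul_nonneg hC (integral_nonneg fun z ↦ by positivity), ?_⟩
  intro s w v δ hδ hδ1 cs cw cv os ew ov bs bw bv hpos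
  have hτ (z : Vec d) : 1 ≤ (1 + ‖z‖) ^ 2 := one_le_pow₀ (by linarith [norm_nonneg z])
  have bs' (z : Vec d) : |s z| ≤ b * (1 + ‖z‖) ^ 2 := (bs z).trans <| by
    gcongr; exact mul_le_of_le_one_left (by positivity) hδ1
  have bw' (z : Vec d) : |w z| ≤ b * (1 + ‖z‖) ^ 2 := (bw z).trans <| by
    gcongr; exact mul_le_of_le_one_left (by positivity) (pow_le_one₀ hδ hδ1)
  have bv' (z : Vec d) : |v z| ≤ b * (1 + ‖z‖) ^ 2 := (bv z).trans <| by
    gcongr; exact mul_le_of_le_one_left (by positivity) (pow_le_one₀ hδ hδ1)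
  have is : Integrable s γ := integrable_of_le_one_add_norm_pow cs _ 2 bs'
  have iw : Integrable w γ := integrable_of_le_one_add_norm_pow cw _ 2 bw'
  have iv : Integrable v γ := integrable_of_le_one_add_norm_pow cv _ 2 bv'
  have is2 : Integrable (fun z ↦ s z ^ 2) γ := by
    refine integrable_of_le_one_add_norm_pow (by fun_prop) (b ^ 2) 4 fun z ↦ ?_
    rw [abs_pow]
    exact (pow_le_pow_left₀ (abs_nonneg _) (bs' z) 2).trans (le_of_eq (by ring))
  have isw : Integrable (fun z ↦ s z * w z) γ := by
    refine integrable_of_le_one_add_norm_pow (by fun_prop) (b ^ 2) 4 fun z ↦ ?_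
    rw [abs_mul]
    exact (mul_le_mul (bs' z) (bw' z) (abs_nonneg _) (by positivity)).trans (le_of_eq (by ring))
  have is3 : Integrable (fun z ↦ s z ^ 3) γ := by
    refine integrable_of_le_one_add_norm_pow (by fun_prop) (b ^ 3) 6 fun z ↦ ?_
    rw [abs_pow]
    exact (pow_le_pow_left₀ (abs_nonneg _) (bs' z) 3).trans (le_of_eq (by ring))
  have iN := integrable_one_add_norm_pow_stdGaussian (d := d) (2 * N)
  -- The odd part of the expansion, which integrates to zero; `i4` is the even part that survives.
  have i1 : Integrable (fun z ↦ q * s z + q * v z + q * (q - 1) * (s z * w z) + c * s z ^ 3) γ :=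
    (((is.const_mul q).add (iv.const_mul q)).add (isw.const_mul _)).add (is3.const_mul c)
  have i2 : Integrable (fun z ↦ 1 + q * w z) γ := (integrable_const 1).add (iw.const_mul q)
  have i3 : Integrable (fun z ↦ 1 + q * w z + q * (q - 1) / 2 * s z ^ 2) γ :=
    i2.add (is2.const_mul _)
  have i4 : Integrable (fun z ↦ 1 + q * w z + q * (q - 1) / 2 * s z ^ 2
      + C * δ ^ 4 * (1 + ‖z‖) ^ (2 * N)) γ := i3.add (iN.const_mul _)
  have hle (z : Vec d) : (1 + (s z + w z + v z)) ^ q ≤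
      (1 + q * w z + q * (q - 1) / 2 * s z ^ 2 + C * δ ^ 4 * (1 + ‖z‖) ^ (2 * N))
      + (q * s z + q * v z + q * (q - 1) * (s z * w z) + c * s z ^ 3) := by
    refine (H (s z) (w z) (v z) δ ((1 + ‖z‖) ^ 2) hδ hδ1 (hτ z) (bs z) (bw z) (bv z)
      (hpos z)).trans (le_of_eq ?_)
    rw [← pow_mul]; ring
  calc _ ≤ ∫⁻ z, ENNReal.ofReal (
        (1 + q * w z + q * (q - 1) / 2 * s z ^ 2 + C * δ ^ 4 * (1 + ‖z‖) ^ (2 * N))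
        + (q * s z + q * v z + q * (q - 1) * (s z * w z) + c * s z ^ 3)) ∂γ :=
        lintegral_mono fun z ↦ ENNReal.ofReal_le_ofReal (hle z)
    _ = ENNReal.ofReal (∫ z, (
        (1 + q * w z + q * (q - 1) / 2 * s z ^ 2 + C * δ ^ 4 * (1 + ‖z‖) ^ (2 * N))
        + (q * s z + q * v z + q * (q - 1) * (s z * w z) + c * s z ^ 3)) ∂γ) :=
        (ofReal_integral_eq_lintegral_ofReal (i4.add i1) (ae_of_all _ fun z ↦
          (Real.rpow_nonneg (hpos z) q).trans (hle z))).symm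
    _ = _ := by
        congr 1
        rw [integral_add i4 i1,
          integral_eq_zero_of_odd_stdGaussian (F := fun z ↦ q * s z + q * v z
            + q * (q - 1) * (s z * w z) + c * s z ^ 3) (fun z ↦ by rw [os, ew, ov]; ring),
          integral_add i3 (iN.const_mul _), integral_add i2 (is2.const_mul _),
          integral_add (integrable_const 1) (iw.const_mul q), integral_const_mul,
          integral_const_mul, integral_const_mul, integral_const]
        simp
        ring

lemma exists_one_add_norm_sq_le_quad {Q : Matrix (Fin n) (Fin n) ℝ} (hQ : Q.PosDef) :
    ∃ κ : ℝ, 0 < κ ∧ ∀ x : Vec n, (1 + ‖x‖) ^ 2 ≤ κ * (1 + quad Q x x) := by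
  obtain ⟨c, hc, H⟩ := exists_mul_norm_sq_le_quad hQ
  refine ⟨2 * (1 + c⁻¹), by positivity, fun x ↦ ?_⟩
  have h1 : ‖x‖ ^ 2 ≤ c⁻¹ * quad Q x x := by
    rw [inv_mul_eq_div, le_div_iff₀ hc]; linarith [H x]
  have h2 := quad_self_nonneg hQ x
  have h3 : 0 < c⁻¹ := by positivity
  nlinarith [sq_nonneg (1 - ‖x‖)]

set_option maxHeartbeats 1000000 in
/-- One Euler-Maruyama step with coefficients of size `H ≤ K Δ^{-1/2}` multiplies the mean of
`(1 + xᵀ Q x) ^ q` by at most `1 + C Δ`, if the generator of the frozen diffusion does so. -/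
lemma lintegral_step_le {Q : Matrix (Fin n) (Fin n) ℝ} (hQ : Q.PosDef) {q : ℝ} (hq : 0 < q)
    {K : ℝ} (hK : 0 ≤ K) (A : ℝ) (d : ℕ) :
    ∃ C : ℝ, 0 ≤ C ∧ ∀ Δ H : ℝ, 0 ≤ Δ → Δ ≤ 1 → √Δ * H ≤ K →
      ∀ (y a : Vec n) (G : Matrix (Fin n) (Fin d) ℝ), ‖a‖ ≤ H * (1 + ‖y‖) →
      traceNorm G ^ 2 ≤ H * (1 + ‖y‖) ^ 2 →
      (1 + quad Q y y) * (2 * quad Q y a + Matrix.trace (Gᵀ * Q * G))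
        - (2 - 2 * q) * ‖rowMul y (Q * G)‖ ^ 2 ≤ A * (1 + quad Q y y) ^ 2 →
      ∫⁻ z, ENNReal.ofReal ((1 + quad Q (y + Δ • a + colMul G (√Δ • z))
          (y + Δ • a + colMul G (√Δ • z))) ^ q) ∂(stdGaussian (Vec d)) ≤
        ENNReal.ofReal ((1 + C * Δ) * (1 + quad Q y y) ^ q) := by
  have hQT : Qᵀ = Q := by simpa using hQ.isHermitian.eq
  obtain ⟨κ, hκ, hκW⟩ := exists_one_add_norm_sq_le_quad hQ
  set β := ‖Matrix.toEuclideanCLM (𝕜 := ℝ) Q‖ with hβ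
  have hβ0 : 0 ≤ β := norm_nonneg _
  -- Chosen so that `K ≤ k` (for the drift), `K ≤ k ^ 2` (for the noise) and `k ≤ k ^ 2`.
  set k := 1 + K with hk
  have hk0 : 0 ≤ k := by positivity
  obtain ⟨C, hC, H1⟩ := lintegral_one_add_rpow_le hq (b := 3 * β * k ^ 2 * κ) (by positivity) d
  -- From the generator bound, the term `Δ² aᵀ Q a`, and the Taylor remainder, respectively.
  refine ⟨q * |A| + q * (β * k ^ 2 * κ) + C, by positivity, ?_⟩
  intro Δ H hΔ hΔ1 hH y a G ha hG hgen
  -- In this scale `Δ a = δ⁴ a` is of order `δ² (1 + |y|)` and `√Δ G z = δ² G z` is of order `δ (1 +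
  -- |y|) |z|`.
  set δ := √(√Δ) with hδ
  have hδ0 : 0 ≤ δ := Real.sqrt_nonneg _
  have hδ2 : δ ^ 2 = √Δ := Real.sq_sqrt (Real.sqrt_nonneg _)
  have hδ4 : δ ^ 4 = Δ := by
    rw [show δ ^ 4 = (δ ^ 2) ^ 2 by ring, hδ2, Real.sq_sqrt hΔ]
  have hδ1 : δ ≤ 1 := Real.sqrt_le_one.2 (Real.sqrt_le_one.2 hΔ1)
  rw [← hδ2] at hH
  set W := 1 + quad Q y y with hW
  have hW1 : 1 ≤ W := by linarith [quad_self_nonneg hQ y]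
  have hW0 : 0 < W := by linarith
  set e := 1 + ‖y‖ with he
  have he1 : 1 ≤ e := by linarith [norm_nonneg y]
  have hye : ‖y‖ ≤ e := by linarith
  have heW : e ^ 2 ≤ κ * W := hκW y
  have hae : δ ^ 2 * ‖a‖ ≤ k * e := by
    calc δ ^ 2 * ‖a‖ ≤ δ ^ 2 * (H * e) := by gcongr
      _ = δ ^ 2 * H * e := by ring
      _ ≤ k * e := by gcongr; linarith
  have hGe : δ * traceNorm G ≤ k * e := by
    refine le_of_sq_le_sq ?_ (by positivity)
    calc (δ * traceNorm G) ^ 2 = δ ^ 2 * traceNorm G ^ 2 := by ring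
      _ ≤ δ ^ 2 * (H * e ^ 2) := by gcongr
      _ = δ ^ 2 * H * e ^ 2 := by ring
      _ ≤ k ^ 2 * e ^ 2 := by gcongr; nlinarith
      _ = (k * e) ^ 2 := by ring
  have hGz (z : Vec d) : δ * ‖colMul G z‖ ≤ k * e * ‖z‖ := by
    calc δ * ‖colMul G z‖ ≤ δ * (traceNorm G * ‖z‖) := by gcongr; exact norm_colMul_le G z
      _ = δ * traceNorm G * ‖z‖ := by ring
      _ ≤ _ := by gcongr
  have hT1 (z : Vec d) : ‖z‖ ≤ (1 + ‖z‖) ^ 2 := by nlinarith [norm_nonneg z]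
  have hT2 (z : Vec d) : 1 + ‖z‖ ^ 2 ≤ (1 + ‖z‖) ^ 2 := by nlinarith [norm_nonneg z]
  have hk1 : 1 ≤ k := by linarith
  have hcont : Continuous fun z : Vec d ↦ colMul G z := by
    unfold colMul; fun_prop
  have hquad : Continuous fun z : Vec d ↦ quad Q (colMul G z) (colMul G z) :=
    (continuous_quad Q).comp hcont
  have hlin (x : Vec n) : Continuous fun z : Vec d ↦ quad Q x (colMul G z) := by
    simp_rw [quad_eq_inner]; fun_prop
  have hneg (x : Vec n) (z : Vec d) : quad Q x (colMul G (-z)) = -quad Q x (colMul G z) := by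
    rw [colMul_neg]; simpa using quad_smul_right Q (-1) x (colMul G z)
  have hnegneg (z : Vec d) : quad Q (colMul G (-z)) (colMul G (-z)) =
      quad Q (colMul G z) (colMul G z) := by
    rw [hneg, colMul_neg]
    have := quad_smul_left Q (-1) (colMul G z) (colMul G z)
    simp only [neg_smul, one_smul] at this
    linarith
  have haa : δ ^ 4 * |quad Q a a| ≤ β * k ^ 2 * κ * W := by
    calc δ ^ 4 * |quad Q a a| ≤ δ ^ 4 * (β * (‖a‖ * ‖a‖)) := by gcongr; exact abs_quad_le Q a a
      _ = β * ((δ ^ 2 * ‖a‖) * (δ ^ 2 * ‖a‖)) := by ring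
      _ ≤ β * ((k * e) * (k * e)) := by gcongr
      _ = β * k ^ 2 * e ^ 2 := by ring
      _ ≤ β * k ^ 2 * (κ * W) := by gcongr
      _ = _ := by ring
  -- The relative increment of `1 + xᵀ Q x`, sorted by order in `δ` and parity in `z`: `s` is odd of
  -- order `δ`, `w` even of order `δ²`, `v` odd of order `δ³`.
  set s : Vec d → ℝ := fun z ↦ 2 * δ ^ 2 * quad Q y (colMul G z) / W with hs
  set w : Vec d → ℝ := fun z ↦ (2 * δ ^ 4 * quad Q y a + δ ^ 8 * quad Q a a
    + δ ^ 4 * quad Q (colMul G z) (colMul G z)) / W with hw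
  set v : Vec d → ℝ := fun z ↦ 2 * δ ^ 6 * quad Q a (colMul G z) / W with hv
  have hxW (z : Vec d) : 1 + quad Q (y + Δ • a + colMul G (√Δ • z))
      (y + Δ • a + colMul G (√Δ • z)) = W * (1 + (s z + w z + v z)) := by
    rw [← hδ2, ← hδ4, colMul_smul, quad_add_self hQT, quad_add_self hQT, quad_add_left]
    simp only [quad_smul_left, quad_smul_right, hs, hw, hv]
    field_simp
    ring
  have hpos (z : Vec d) : 0 ≤ 1 + (s z + w z + v z) := by
    have h1 := hxW z
    have h2 := quad_self_nonneg hQ (y + Δ • a + colMul G (√Δ • z))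
    by_contra hlt
    push Not at hlt
    nlinarith [mul_neg_of_pos_of_neg hW0 hlt]
  have bs (z : Vec d) : |s z| ≤ 3 * β * k ^ 2 * κ * (δ * (1 + ‖z‖) ^ 2) := by
    rw [hs, abs_div, abs_of_pos hW0, div_le_iff₀ hW0, abs_mul, abs_of_nonneg (by positivity)]
    calc 2 * δ ^ 2 * |quad Q y (colMul G z)|
        ≤ 2 * δ ^ 2 * (β * (‖y‖ * ‖colMul G z‖)) := by gcongr; exact abs_quad_le _ _ _
      _ = 2 * δ * β * ‖y‖ * (δ * ‖colMul G z‖) := by ring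
      _ ≤ 2 * δ * β * e * (k * e * ‖z‖) :=
          mul_le_mul (by gcongr) (hGz z) (by positivity) (by positivity)
      _ = δ * β * (2 * k * ‖z‖) * e ^ 2 := by ring
      _ ≤ δ * β * (3 * k ^ 2 * (1 + ‖z‖) ^ 2) * (κ * W) := by
          gcongr
          · norm_num
          · exact le_self_pow₀ hk1 two_ne_zero
          · exact hT1 z
      _ = _ := by ring
  have bv (z : Vec d) : |v z| ≤ 3 * β * k ^ 2 * κ * (δ ^ 3 * (1 + ‖z‖) ^ 2) := by
    rw [hv, abs_div, abs_of_pos hW0, div_le_iff₀ hW0, abs_mul, abs_of_nonneg (by positivity)]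
    calc 2 * δ ^ 6 * |quad Q a (colMul G z)|
        ≤ 2 * δ ^ 6 * (β * (‖a‖ * ‖colMul G z‖)) := by gcongr; exact abs_quad_le _ _ _
      _ = 2 * δ ^ 3 * β * ((δ ^ 2 * ‖a‖) * (δ * ‖colMul G z‖)) := by ring
      _ ≤ 2 * δ ^ 3 * β * ((k * e) * (k * e * ‖z‖)) :=
          mul_le_mul_of_nonneg_left (mul_le_mul hae (hGz z) (by positivity) (by positivity))
            (by positivity)
      _ = δ ^ 3 * β * (2 * k ^ 2 * ‖z‖) * e ^ 2 := by ring
      _ ≤ δ ^ 3 * β * (3 * k ^ 2 * (1 + ‖z‖) ^ 2) * (κ * W) := by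
          gcongr
          · norm_num
          · exact hT1 z
      _ = _ := by ring
  have bw (z : Vec d) : |w z| ≤ 3 * β * k ^ 2 * κ * (δ ^ 2 * (1 + ‖z‖) ^ 2) := by
    rw [hw, abs_div, abs_of_pos hW0, div_le_iff₀ hW0]
    have t1 : |2 * δ ^ 4 * quad Q y a| ≤ 2 * β * k * δ ^ 2 * e ^ 2 := by
      rw [abs_mul, abs_of_nonneg (by positivity)]
      calc 2 * δ ^ 4 * |quad Q y a| ≤ 2 * δ ^ 4 * (β * (‖y‖ * ‖a‖)) := by
            gcongr; exact abs_quad_le _ _ _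
        _ = 2 * δ ^ 2 * β * ‖y‖ * (δ ^ 2 * ‖a‖) := by ring
        _ ≤ 2 * δ ^ 2 * β * e * (k * e) := by gcongr
        _ = _ := by ring
    have t2 : |δ ^ 8 * quad Q a a| ≤ β * k ^ 2 * δ ^ 2 * e ^ 2 := by
      rw [abs_mul, abs_of_nonneg (by positivity)]
      calc δ ^ 8 * |quad Q a a| ≤ δ ^ 8 * (β * (‖a‖ * ‖a‖)) := by
            gcongr; exact abs_quad_le _ _ _
        _ = δ ^ 4 * β * ((δ ^ 2 * ‖a‖) * (δ ^ 2 * ‖a‖)) := by ring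
        _ ≤ δ ^ 2 * β * ((k * e) * (k * e)) := by
            have := pow_le_pow_of_le_one hδ0 hδ1 (show 2 ≤ 4 by norm_num); gcongr
        _ = _ := by ring
    have t3 : |δ ^ 4 * quad Q (colMul G z) (colMul G z)| ≤ β * k ^ 2 * δ ^ 2 * e ^ 2 * ‖z‖ ^ 2 := by
      rw [abs_mul, abs_of_nonneg (by positivity)]
      calc δ ^ 4 * |quad Q (colMul G z) (colMul G z)|
          ≤ δ ^ 4 * (β * (‖colMul G z‖ * ‖colMul G z‖)) := by
            gcongr; exact abs_quad_le _ _ _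
        _ = δ ^ 2 * β * ((δ * ‖colMul G z‖) * (δ * ‖colMul G z‖)) := by ring
        _ ≤ δ ^ 2 * β * ((k * e * ‖z‖) * (k * e * ‖z‖)) :=
            mul_le_mul_of_nonneg_left (mul_le_mul (hGz z) (hGz z) (by positivity) (by positivity))
              (by positivity)
        _ = _ := by ring
    have hkk : 2 * k + k ^ 2 + k ^ 2 * ‖z‖ ^ 2 ≤ 3 * k ^ 2 * (1 + ‖z‖) ^ 2 := by
      have h1 : k ≤ k ^ 2 := le_self_pow₀ hk1 two_ne_zero
      have h2 : 0 ≤ k ^ 2 * ‖z‖ ^ 2 := by positivity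
      have h3 : 3 * k ^ 2 * (1 + ‖z‖ ^ 2) ≤ 3 * k ^ 2 * (1 + ‖z‖) ^ 2 := by gcongr; exact hT2 z
      linarith
    calc _ ≤ 2 * β * k * δ ^ 2 * e ^ 2 + β * k ^ 2 * δ ^ 2 * e ^ 2
          + β * k ^ 2 * δ ^ 2 * e ^ 2 * ‖z‖ ^ 2 :=
          (abs_add_three _ _ _).trans (add_le_add (add_le_add t1 t2) t3)
      _ = β * δ ^ 2 * (2 * k + k ^ 2 + k ^ 2 * ‖z‖ ^ 2) * e ^ 2 := by ring
      _ ≤ β * δ ^ 2 * (3 * k ^ 2 * (1 + ‖z‖) ^ 2) * (κ * W) := by gcongr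
      _ = _ := by ring
  have hint := H1 s w v δ hδ0 hδ1 (by fun_prop) (by fun_prop) (by fun_prop)
    (fun z ↦ by simp only [hs, hneg]; ring) (fun z ↦ by simp only [hw, hnegneg])
    (fun z ↦ by simp only [hv, hneg]; ring) bs bw bv hpos
  have Is : ∫ z, s z ^ 2 ∂(stdGaussian (Vec d)) =
      4 * δ ^ 4 * ‖rowMul y (Q * G)‖ ^ 2 / W ^ 2 := by
    rw [← integral_inner_sq_stdGaussian, mul_div_right_comm, ← integral_const_mul]
    refine integral_congr_ae (ae_of_all _ fun z ↦ ?_)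
    simp only [hs, quad_colMul_right]
    ring_nf
  have Iw : ∫ z, w z ∂(stdGaussian (Vec d)) = (2 * δ ^ 4 * quad Q y a + δ ^ 8 * quad Q a a
      + δ ^ 4 * Matrix.trace (Gᵀ * Q * G)) / W := by
    have hI : Integrable (fun z : Vec d ↦ quad Q (colMul G z) (colMul G z))
        (stdGaussian (Vec d)) := by
      refine integrable_of_le_one_add_norm_pow hquad (β * traceNorm G ^ 2) 2 fun z ↦ ?_
      calc _ ≤ β * (‖colMul G z‖ * ‖colMul G z‖) := abs_quad_le _ _ _
        _ ≤ β * ((traceNorm G * ‖z‖) * (traceNorm G * ‖z‖)) := by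
            have := norm_colMul_le G z
            have := traceNorm_nonneg G
            gcongr
        _ = β * traceNorm G ^ 2 * ‖z‖ ^ 2 := by ring
        _ ≤ _ := by gcongr; linarith
    rw [integral_div, integral_add (integrable_const _) (hI.const_mul _), integral_const_mul,
      integral_quad_colMul_stdGaussian]
    simp
  simp_rw [hxW, Real.mul_rpow hW0.le (hpos _),
    ENNReal.ofReal_mul (Real.rpow_nonneg hW0.le q)]
  rw [lintegral_const_mul' _ _ ENNReal.ofReal_ne_top]
  rw [mul_comm (1 + _), ENNReal.ofReal_mul (Real.rpow_nonneg hW0.le q)]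
  refine mul_le_mul_right (hint.trans (ENNReal.ofReal_le_ofReal ?_)) _
  rw [Is, Iw]
  -- Since `q (q - 1) / 2 * 4 = -q (2 - 2q)`, the two surviving averages combine into the expression
  -- bounded by `hgen`.
  have e1 : q * ((2 * δ ^ 4 * quad Q y a + δ ^ 8 * quad Q a a
      + δ ^ 4 * Matrix.trace (Gᵀ * Q * G)) / W)
      + q * (q - 1) / 2 * (4 * δ ^ 4 * ‖rowMul y (Q * G)‖ ^ 2 / W ^ 2)
      = q * δ ^ 4 * ((W * (2 * quad Q y a + Matrix.trace (Gᵀ * Q * G))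
        - (2 - 2 * q) * ‖rowMul y (Q * G)‖ ^ 2) / W ^ 2)
        + q * δ ^ 4 * (δ ^ 4 * quad Q a a / W) := by
    field_simp
    ring
  have e2 : (W * (2 * quad Q y a + Matrix.trace (Gᵀ * Q * G))
        - (2 - 2 * q) * ‖rowMul y (Q * G)‖ ^ 2) / W ^ 2 ≤ |A| := by
    rw [div_le_iff₀ (by positivity)]
    exact hgen.trans (mul_le_mul_of_nonneg_right (le_abs_self A) (by positivity))
  have e3 : δ ^ 4 * quad Q a a / W ≤ β * k ^ 2 * κ := by
    rw [div_le_iff₀ hW0]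
    exact (mul_le_mul_of_nonneg_left (le_abs_self _) (by positivity)).trans haa
  have e4 : q * δ ^ 4 * ((W * (2 * quad Q y a + Matrix.trace (Gᵀ * Q * G))
        - (2 - 2 * q) * ‖rowMul y (Q * G)‖ ^ 2) / W ^ 2)
        + q * δ ^ 4 * (δ ^ 4 * quad Q a a / W)
      ≤ q * δ ^ 4 * |A| + q * δ ^ 4 * (β * k ^ 2 * κ) := by gcongr
  rw [← hδ4]
  linarith

end TruncatedEM

namespace TruncatedEM

variable {n d m : ℕ} {f : Vec n → Fin m → Vec n} {g : Vec n → Fin m → Matrix (Fin n) (Fin d) ℝ}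

/-! ### Consequences of the conditions on the coefficients -/

lemma abs_entry_le_traceNorm (A : Matrix (Fin n) (Fin d) ℝ) (a : Fin n) (j : Fin d) :
    |A a j| ≤ traceNorm A := by
  refine abs_le_of_sq_le_sq ?_ (traceNorm_nonneg A)
  rw [traceNorm_sq]
  exact (Finset.single_le_sum (f := fun j ↦ A a j ^ 2) (fun _ _ ↦ sq_nonneg _)
    (Finset.mem_univ j)).trans (Finset.single_le_sum (f := fun a ↦ ∑ j, A a j ^ 2)
      (fun _ _ ↦ Finset.sum_nonneg fun _ _ ↦ sq_nonneg _) (Finset.mem_univ a))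

lemma continuous_of_locally_lipschitz_bound {F : Vec n → ℝ}
    (h : ∀ N : ℝ, 0 < N → ∃ C : ℝ, 0 < C ∧ ∀ x y : Vec n, max ‖x‖ ‖y‖ ≤ N →
      |F x - F y| ≤ C * ‖x - y‖) : Continuous F := by
  rw [continuous_iff_continuousAt]
  intro x
  obtain ⟨C, hC, H⟩ := h (‖x‖ + 1) (by positivity)
  refine tendsto_iff_dist_tendsto_zero.2 ?_
  have h0 : Tendsto (fun y ↦ C * ‖y - x‖) (𝓝 x) (𝓝 0) := by
    have : Continuous fun y ↦ C * ‖y - x‖ := by fun_prop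
    simpa using this.tendsto x
  refine squeeze_zero' (Eventually.of_forall fun _ ↦ dist_nonneg) ?_ h0
  filter_upwards [Metric.ball_mem_nhds x one_pos] with y hy
  refine H y x (max_le ?_ (by linarith))
  have := norm_sub_norm_le y x
  rw [Metric.mem_ball, dist_eq_norm] at hy
  linarith

lemma LocallyLipschitzCoeff.continuous_drift (hfg : LocallyLipschitzCoeff f g) (i : Fin m) :
    Continuous fun x ↦ f x i := by
  refine (PiLp.continuous_toLp 2 _).comp (continuous_pi fun a ↦ ?_) (f := fun x ↦ (f x i).ofLp)
  refine continuous_of_locally_lipschitz_bound fun N hN ↦ ?_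
  obtain ⟨C, hC, H⟩ := hfg N hN
  refine ⟨C, hC, fun x y hxy ↦ ?_⟩
  have := PiLp.norm_apply_le (f x i - f y i) a
  exact this.trans ((le_max_left _ _).trans (H x y hxy i))

lemma LocallyLipschitzCoeff.continuous_diffusion (hfg : LocallyLipschitzCoeff f g) (i : Fin m) :
    Continuous fun x ↦ g x i := by
  refine continuous_matrix fun a j ↦ continuous_of_locally_lipschitz_bound fun N hN ↦ ?_
  obtain ⟨C, hC, H⟩ := hfg N hN
  refine ⟨C, hC, fun x y hxy ↦ ?_⟩
  exact (abs_entry_le_traceNorm (g x i - g y i) a j).trans ((le_max_right _ _).trans (H x y hxy i))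

/-- The growth condition at infinity and local boundedness give a bound on the whole space. -/
lemma GrowthAssumption.exists_bound {pbar : ℝ} (hA : GrowthAssumption f g pbar)
    (hfg : LocallyLipschitzCoeff f g) (i : Fin m) :
    ∃ (Q : Matrix (Fin n) (Fin n) ℝ) (A : ℝ), Q.PosDef ∧ ∀ x,
      (1 + quad Q x x) * psi f g Q x i - (2 - pbar) * ‖rowMul x (Q * g x i)‖ ^ 2
        ≤ A * (1 + quad Q x x) ^ 2 := by
  obtain ⟨Q, α, hQ, hlim⟩ := hA.2 i
  have hev := eventually_lt_of_limsup_lt (hlim.trans_lt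
    (EReal.coe_lt_coe_iff.2 (lt_add_one α)))
  rw [(Metric.hasBasis_cobounded_compl_closedBall (0 : Vec n)).eventually_iff] at hev
  obtain ⟨R, -, hR⟩ := hev
  have cf := hfg.continuous_drift i
  have cg := hfg.continuous_diffusion i
  have cq := continuous_quad Q
  have cn : Continuous fun x : Vec n ↦
      (1 + quad Q x x) * psi f g Q x i - (2 - pbar) * ‖rowMul x (Q * g x i)‖ ^ 2 := by
    have c1 : Continuous fun x : Vec n ↦ psi f g Q x i := by
      unfold psi
      simp_rw [quad_eq_inner Q _ (f _ i)]
      fun_prop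
    have c2 : Continuous fun x : Vec n ↦ rowMul x (Q * g x i) := by
      unfold rowMul
      fun_prop
    fun_prop
  -- The radius `max R 0` makes every point outside the ball nonzero, so the denominator `(xᵀ Q x) ^
  -- 2` is positive there.
  obtain ⟨b, hb⟩ := (isCompact_closedBall (0 : Vec n) (max R 0)).exists_bound_of_continuousOn
    cn.continuousOn
  -- A nonnegative constant is needed to enlarge `(xᵀ Q x) ^ 2` to `(1 + xᵀ Q x) ^ 2`.
  refine ⟨Q, max |b| |α + 1|, hQ, fun x ↦ ?_⟩
  have hq := quad_self_nonneg hQ x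
  by_cases hx : x ∈ Metric.closedBall (0 : Vec n) (max R 0)
  · calc _ ≤ b := (le_abs_self _).trans (hb x hx)
      _ ≤ max |b| |α + 1| := (le_abs_self b).trans (le_max_left _ _)
      _ ≤ _ := le_mul_of_one_le_right (le_max_of_le_left (abs_nonneg b))
        (one_le_pow₀ (by linarith))
  · have hx' : max R 0 < ‖x‖ := by simpa using hx
    have hx0 : x ≠ 0 := norm_pos_iff.1 ((le_max_right _ _).trans_lt hx')
    have h1 := hR (x := x) (by simpa using (le_max_left R 0).trans_lt hx')
    rw [EReal.coe_lt_coe_iff, div_lt_iff₀ (pow_pos (quad_self_pos hQ hx0) 2)] at h1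
    refine h1.le.trans ?_
    have : α + 1 ≤ max |b| |α + 1| := (le_abs_self _).trans (le_max_right _ _)
    have h0 : 0 ≤ max |b| |α + 1| := le_max_of_le_left (abs_nonneg b)
    gcongr
    linarith

/-! ### The truncation -/

/-- Truncation is a radial contraction, so it decreases all the forms `xᵀ Q_i x` at once, whichever
state sets the radius. -/
lemma exists_truncate_eq_smul (ρ : ℝ≥0∞) (x : Vec n) :
    ∃ c : ℝ, 0 ≤ c ∧ c ≤ 1 ∧ truncate ρ x = c • x := by
  refine ⟨(min (ENNReal.ofReal ‖x‖) ρ).toReal * ‖x‖⁻¹, by positivity, ?_, ?_⟩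
  · have : (min (ENNReal.ofReal ‖x‖) ρ).toReal ≤ ‖x‖ :=
      ENNReal.toReal_le_of_le_ofReal (norm_nonneg x) (min_le_left _ _)
    exact (mul_le_mul_of_nonneg_right this (by positivity)).trans (mul_inv_le_one)
  · rw [truncate, smul_smul]

lemma quad_truncate_le {Q : Matrix (Fin n) (Fin n) ℝ} (hQ : Q.PosDef) (ρ : ℝ≥0∞) (x : Vec n) :
    quad Q (truncate ρ x) (truncate ρ x) ≤ quad Q x x := by
  obtain ⟨c, h0, h1, h⟩ := exists_truncate_eq_smul ρ x
  rw [h, quad_smul_left, quad_smul_right, ← mul_assoc]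
  exact mul_le_of_le_one_left (quad_self_nonneg hQ x) (mul_le_one₀ h1 h0 h1)

lemma norm_truncate_ofReal_le {u : ℝ} (hu : 0 ≤ u) (x : Vec n) :
    ‖truncate (ENNReal.ofReal u) x‖ ≤ u := by
  have h1 : (min (ENNReal.ofReal ‖x‖) (ENNReal.ofReal u)).toReal ≤ u :=
    ENNReal.toReal_le_of_le_ofReal hu (min_le_right _ _)
  rw [truncate, norm_smul, Real.norm_of_nonneg ENNReal.toReal_nonneg]
  refine (mul_le_of_le_one_right ENNReal.toReal_nonneg ?_).trans h1
  rw [norm_smul, norm_inv, norm_norm]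
  exact inv_mul_le_one

lemma measurable_truncate (ρ : ℝ≥0∞) : Measurable fun x : Vec n ↦ truncate ρ x := by
  unfold truncate
  fun_prop

/-- The purpose of the truncation: its radius is where the growth rate `φ` reaches `H`. A constant
`φ` is at most `H` everywhere, and no truncation is needed. -/
lemma IsGrowthBound.norm_le {i : Fin m} {φ : ℝ → ℝ} (hφ : IsGrowthBound f g i φ) {H : ℝ}
    (hH : φ 1 ≤ H) (x : Vec n) :
    ‖f (truncate (growthInv φ H) x) i‖ ≤ H * (1 + ‖truncate (growthInv φ H) x‖) ∧
      traceNorm (g (truncate (growthInv φ H) x) i) ^ 2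
        ≤ H * (1 + ‖truncate (growthInv φ H) x‖) ^ 2 := by
  set y := truncate (growthInv φ H) x with hy
  obtain ⟨u, hu1, hyu, hu⟩ : ∃ u, 1 ≤ u ∧ ‖y‖ ≤ u ∧ φ u ≤ H := by
    by_cases hc : ConstFromOne φ
    · exact ⟨max ‖y‖ 1, le_max_right _ _, le_max_left _ _, (hc _ (le_max_right _ _)).trans_le hH⟩
    · obtain ⟨-, hcont, htop⟩ := hφ.shape.resolve_right hc
      obtain ⟨b, hb1, hbH⟩ := ((eventually_ge_atTop 1).and (htop.eventually_ge_atTop H)).exists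
      obtain ⟨u, hu, hφu⟩ := intermediate_value_Icc hb1 (hcont.mono Icc_subset_Ici_self) ⟨hH, hbH⟩
      -- `Function.invFunOn` inverts `φ` only at attained values; the intermediate value theorem
      -- shows that `H` is one.
      have hex : ∃ a ∈ Ici (1 : ℝ), φ a = H := ⟨u, hu.1, hφu⟩
      have hmem := Function.invFunOn_mem hex
      refine ⟨_, hmem, ?_, (Function.invFunOn_eq hex).le⟩
      rw [hy, growthInv, if_neg hc]
      exact norm_truncate_ofReal_le (zero_le_one.trans hmem) x
  have hb := (hφ.bound u hu1 y hyu).trans hu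
  have hpos : 0 < 1 + ‖y‖ := by positivity
  exact ⟨(div_le_iff₀ hpos).1 ((le_max_left _ _).trans hb),
    (div_le_iff₀ (pow_pos hpos 2)).1 ((le_max_right _ _).trans hb)⟩

lemma IsGrowthBound.apply_one_le {i : Fin m} {φ : ℝ → ℝ} (hφ : IsGrowthBound f g i φ) {u : ℝ}
    (hu : 1 ≤ u) : φ 1 ≤ φ u := by
  rcases hφ.shape with h | h
  · exact h.1.monotoneOn (self_mem_Ici) hu hu
  · exact (h u hu).ge

/-! ### Measurability of the scheme -/

lemma continuous_step (hfg : LocallyLipschitzCoeff f g) (i : Fin m) (Δ : ℝ) :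
    Continuous fun p : Vec n × Vec d ↦ p.1 + Δ • f p.1 i + colMul (g p.1 i) p.2 := by
  have cf := hfg.continuous_drift i
  have cg := hfg.continuous_diffusion i
  unfold colMul
  fun_prop

section Measurability

variable {Ω : Type*} [MeasurableSpace Ω] {φ : Fin m → ℝ → ℝ} {h : ℝ → ℝ} {x₀ : Vec n}
  {B : ℝ≥0 → Ω → Vec d} {r : ℝ≥0 → Ω → Fin m} {Δ : ℝ≥0}

lemma measurable_apply_of_countable {ι α β : Type*} [MeasurableSpace α]
    [MeasurableSpace β] [MeasurableSpace ι] [Countable ι] [MeasurableSingletonClass ι]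
    {F : ι → α → β} (hF : ∀ i, Measurable (F i)) {R : Ω → ι} (hR : Measurable R)
    {X : Ω → α} (hX : Measurable X) : Measurable fun ω ↦ F (R ω) (X ω) :=
  (measurable_from_prod_countable_right (f := fun p : ι × α ↦ F p.1 p.2) hF).comp (hR.prodMk hX)

lemma measurable_truncate_growthInv {X : Ω → Vec n} (hX : Measurable X) {R : Ω → Fin m}
    (hR : Measurable R) (y : ℝ) :
    Measurable fun ω ↦ truncate (growthInv (φ (R ω)) y) (X ω) :=
  measurable_apply_of_countable (F := fun i x ↦ truncate (growthInv (φ i) y) x)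
    (fun i ↦ measurable_truncate (growthInv (φ i) y)) hR hX

/-- Only the increments before step `k` enter the hypotheses, so the result also applies with the
`σ`-algebra `pastIncrements` on `Ω`. -/
lemma measurable_preScheme (hfg : LocallyLipschitzCoeff f g) (k : ℕ)
    (hB : ∀ j < k, Measurable fun ω ↦ B ((j + 1 : ℕ) * Δ) ω - B (j * Δ) ω)
    (hr : ∀ j < k, Measurable (r (j * Δ))) :
    Measurable (preScheme f g φ h x₀ B r Δ k) := by
  induction k with
  | zero => exact measurable_const
  | succ k ih =>
    have hX := ih (fun j hj ↦ hB j (hj.trans k.lt_succ_self))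
      fun j hj ↦ hr j (hj.trans k.lt_succ_self)
    have hR := hr k k.lt_succ_self
    have hY := measurable_truncate_growthInv (φ := φ) hX hR (h Δ)
    exact measurable_apply_of_countable
      (F := fun i (p : Vec n × Vec d) ↦ p.1 + (Δ : ℝ) • f p.1 i + colMul (g p.1 i) p.2)
      (fun i ↦ (continuous_step hfg i Δ).measurable) hR (hY.prodMk (hB k k.lt_succ_self))

lemma measurable_scheme (hfg : LocallyLipschitzCoeff f g) (k : ℕ)
    (hB : ∀ j < k, Measurable fun ω ↦ B ((j + 1 : ℕ) * Δ) ω - B (j * Δ) ω)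
    (hr : ∀ j ≤ k, Measurable (r (j * Δ))) :
    Measurable (scheme f g φ h x₀ B r Δ k) :=
  measurable_truncate_growthInv (measurable_preScheme hfg k hB fun j hj ↦ hr j hj.le)
    (hr k le_rfl) (h Δ)

end Measurability

end TruncatedEM

namespace TruncatedEM

variable {Ω : Type*} [MeasurableSpace Ω] {P : Measure Ω} {d m : ℕ}

/-! ### Brownian increments -/

/-- The `σ`-algebra of the increments of `B` over the first `k` steps of length `Δ`. -/
abbrev pastIncrements {Ω : Type*} (B : ℝ≥0 → Ω → Vec d) (Δ : ℝ≥0) (k : ℕ) : MeasurableSpace Ω :=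
  ⨆ p ∈ {p : Fin d × ℕ | p.2 < k}, MeasurableSpace.comap
    (fun ω ↦ B ((p.2 + 1 : ℕ) * Δ) ω p.1 - B (p.2 * Δ) ω p.1) inferInstance

lemma measurable_of_coord {Ω : Type*} {mΩ : MeasurableSpace Ω} {X : Ω → Vec d}
    (h : ∀ a, Measurable fun ω ↦ X ω a) : Measurable X :=
  (WithLp.measurable_toLp 2 (Fin d → ℝ)).comp (measurable_pi_lambda (fun ω ↦ (X ω).ofLp) h)

lemma measurable_increment_pastIncrements {Ω : Type*} (B : ℝ≥0 → Ω → Vec d) (Δ : ℝ≥0)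
    {j k : ℕ} (hjk : j < k) :
    Measurable[pastIncrements B Δ k] fun ω ↦ B ((j + 1 : ℕ) * Δ) ω - B (j * Δ) ω :=
  measurable_of_coord fun a ↦ measurable_iff_comap_le.2 (le_iSup₂_of_le (a, j) hjk le_rfl)

/-- Independence across coordinates and across time makes the doubly indexed family of scalar
increments independent; the blocks before step `k` and from step `k` on are disjoint. -/
lemma IsBrownianMotion.indepFun_increment [IsProbabilityMeasure P] {B : ℝ≥0 → Ω → Vec d}
    (hB : IsBrownianMotion B P) (Δ : ℝ≥0) (k : ℕ) {α : Type*} [MeasurableSpace α] {Y : Ω → α}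
    (hY : Measurable[pastIncrements B Δ k] Y) :
    IndepFun Y (fun ω ↦ B ((k + 1 : ℕ) * Δ) ω - B (k * Δ) ω) P := by
  set X : Fin d → ℕ → Ω → ℝ := fun a j ω ↦ B ((j + 1 : ℕ) * Δ) ω a - B (j * Δ) ω a with hX
  have mB (t : ℝ≥0) (a : Fin d) : Measurable fun ω ↦ B t ω a := by
    have := hB.measurable t
    fun_prop
  have mX (a : Fin d) (j : ℕ) : Measurable (X a j) := (mB _ a).sub (mB _ a)
  have h1 : iIndepFun (fun a ω ↦ (X a · ω)) P :=
    hB.indep.comp (fun _ (b : ℝ≥0 → ℝ) (j : ℕ) ↦ b ((j + 1 : ℕ) * Δ) - b (j * Δ))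
      fun _ ↦ by fun_prop
  have h2 (a : Fin d) : iIndepFun (X a) P :=
    (hB.coord a).toIsPreBrownianReal.hasIndepIncrements.nat (t := fun j : ℕ ↦ (j : ℝ≥0) * Δ)
      fun i j hij ↦ by dsimp only; gcongr
  have h3 : iIndepFun (fun (p : Fin d × ℕ) ω ↦ X p.1 p.2 ω) P := iIndepFun_uncurry' mX h1 h2
  have hdisj : Disjoint {p : Fin d × ℕ | p.2 < k} {p : Fin d × ℕ | k ≤ p.2} :=
    Set.disjoint_left.2 fun p (hp : p.2 < k) (hp' : k ≤ p.2) ↦ absurd hp (not_lt.2 hp')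
  have h4 := indep_iSup_of_disjoint
    (m := fun p : Fin d × ℕ ↦ MeasurableSpace.comap (X p.1 p.2) inferInstance)
    (fun p ↦ (mX p.1 p.2).comap_le) h3.iIndep hdisj
  refine indep_of_indep_of_le_left (indep_of_indep_of_le_right h4 ?_) hY.comap_le
  rw [← measurable_iff_comap_le]
  exact measurable_of_coord fun a ↦ measurable_iff_comap_le.2
    (le_iSup₂_of_le (a, k) (le_refl k) le_rfl)

lemma IsBrownianMotion.map_increment [IsProbabilityMeasure P] {B : ℝ≥0 → Ω → Vec d}
    (hB : IsBrownianMotion B P) {Δ : ℝ≥0} (hΔ : 0 < Δ) (k : ℕ) :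
    P.map (fun ω ↦ (√(Δ : ℝ))⁻¹ • (B ((k + 1 : ℕ) * Δ) ω - B (k * Δ) ω)) =
      stdGaussian (Vec d) := by
  have hs : (√(Δ : ℝ)) ^ 2 = Δ := Real.sq_sqrt Δ.2
  have hs0 : (√(Δ : ℝ)) ≠ 0 := by
    have : (0 : ℝ) < Δ := hΔ
    positivity
  set Z : Fin d → Ω → ℝ := fun a ω ↦
    (√(Δ : ℝ))⁻¹ * (B ((k + 1 : ℕ) * Δ) ω a - B (k * Δ) ω a) with hZ
  have hlaw (a : Fin d) : HasLaw (Z a) (gaussianReal 0 1) P := by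
    have h := gaussianReal_const_mul
      ((hB.coord a).toIsPreBrownianReal.hasLaw_sub ((k + 1 : ℕ) * Δ) (k * Δ)) (√(Δ : ℝ))⁻¹
    have hv : NNReal.mk ((√(Δ : ℝ))⁻¹ ^ 2) (sq_nonneg _) *
        nndist (((k + 1 : ℕ) * Δ : ℝ≥0) : ℝ) ((k * Δ : ℝ≥0) : ℝ) = 1 := by
      rw [← NNReal.coe_inj]
      push_cast
      rw [Real.dist_eq, show ((k : ℝ) + 1) * Δ - k * Δ = Δ by ring,
        abs_of_nonneg (NNReal.coe_nonneg Δ)]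
      rw [inv_pow, hs]
      exact inv_mul_cancel₀ (by exact_mod_cast hΔ.ne')
    rw [mul_zero] at h
    exact hv ▸ h
  have hind : iIndepFun Z P :=
    hB.indep.comp (fun _ (b : ℝ≥0 → ℝ) ↦ (√(Δ : ℝ))⁻¹ * (b ((k + 1 : ℕ) * Δ) - b (k * Δ)))
      fun _ ↦ by fun_prop
  have hpi := (iIndepFun_iff_map_fun_eq_pi_map fun a ↦ (hlaw a).aemeasurable).1 hind
  simp_rw [fun a ↦ (hlaw a).map_eq] at hpi
  have mZ (a : Fin d) : Measurable (Z a) := by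
    have := hB.measurable ((k + 1 : ℕ) * Δ)
    have := hB.measurable (k * Δ)
    fun_prop
  rw [← map_pi_eq_stdGaussian, ← hpi, Measure.map_map (WithLp.measurable_toLp 2 _)
    (measurable_pi_lambda _ mZ)]
  rfl

/-! ### Switches of the Markov chain -/

/-- For `Δ < ε` the rate expansion gives slope `1 + |Γ i j|`; for `Δ ≥ ε` the trivial bound `1 ≤ ε⁻¹
* Δ` suffices. -/
lemma IsTransitionFunction.exists_le_mul {p : ℝ≥0 → Matrix (Fin m) (Fin m) ℝ}
    {Γ : Matrix (Fin m) (Fin m) ℝ} (hp : IsTransitionFunction p Γ) :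
    ∃ C : ℝ, 0 ≤ C ∧ ∀ (Δ : ℝ≥0) (i j : Fin m), i ≠ j → 0 < Δ → p Δ i j ≤ C * Δ := by
  have hij (i j : Fin m) (h : i ≠ j) : ∃ C : ℝ, 0 ≤ C ∧ ∀ Δ : ℝ≥0, 0 < Δ → p Δ i j ≤ C * Δ := by
    have hr := (hp.rate i j).bound one_pos
    simp only [if_neg h, zero_add, one_mul] at hr
    rw [eventually_nhdsWithin_iff, Metric.eventually_nhds_iff] at hr
    obtain ⟨ε, hε, H⟩ := hr
    refine ⟨1 + |Γ i j| + ε⁻¹, by positivity, fun Δ hΔ ↦ ?_⟩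
    have hΔ' : (0 : ℝ) < Δ := hΔ
    rcases lt_or_ge (Δ : ℝ) ε with hlt | hge
    · have h1 := H (y := Δ) (by simpa [NNReal.dist_eq] using hlt) hΔ
      rw [Real.norm_eq_abs, Real.norm_eq_abs, abs_of_pos hΔ'] at h1
      have h2 := (abs_le.1 h1).2
      have h3 : Γ i j * Δ ≤ |Γ i j| * Δ := mul_le_mul_of_nonneg_right (le_abs_self _) hΔ'.le
      have h4 : 0 ≤ ε⁻¹ * Δ := by positivity
      linarith
    · have h1 : p Δ i j ≤ 1 := by
        rw [← hp.row_sum Δ i]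
        exact Finset.single_le_sum (f := fun j ↦ p Δ i j) (fun j _ ↦ hp.nonneg Δ i j)
          (Finset.mem_univ j)
      have h2 : 1 ≤ ε⁻¹ * Δ := by rw [inv_mul_eq_div]; exact (one_le_div hε).2 hge
      have h3 : 0 ≤ |Γ i j| * Δ := by positivity
      linarith
  choose! C hC0 hC using hij
  refine ⟨∑ i, ∑ j, |C i j|, by positivity, fun Δ i j h hΔ ↦ (hC i j h Δ hΔ).trans ?_⟩
  refine mul_le_mul_of_nonneg_right ?_ Δ.2
  exact (le_abs_self _).trans ((Finset.single_le_sum (f := fun j ↦ |C i j|)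
    (fun _ _ ↦ abs_nonneg _) (Finset.mem_univ j)).trans (Finset.single_le_sum
      (f := fun i ↦ ∑ j, |C i j|) (fun _ _ ↦ by positivity) (Finset.mem_univ i)))

/-- `M` to the number of `j < k` such that the path `ρ` takes different values at `jΔ` and
`(j + 1)Δ`. -/
noncomputable def switchWeight (M : ℝ≥0∞) (Δ : ℝ≥0) (ρ : ℝ≥0 → Fin m) : ℕ → ℝ≥0∞
  | 0 => 1
  | k + 1 => switchWeight M Δ ρ k * if ρ (k * Δ) = ρ ((k + 1 : ℕ) * Δ) then 1 else M

lemma measurable_switchWeight (M : ℝ≥0∞) (Δ : ℝ≥0) {Ω : Type*} [MeasurableSpace Ω]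
    {r : ℝ≥0 → Ω → Fin m} (k : ℕ) (hr : ∀ j ≤ k, Measurable (r (j * Δ))) :
    Measurable fun ω ↦ switchWeight M Δ (fun t ↦ r t ω) k := by
  induction k with
  | zero => exact measurable_const
  | succ k ih =>
    refine (ih fun j hj ↦ hr j (hj.trans k.le_succ)).mul (Measurable.ite ?_ measurable_const
      measurable_const)
    exact measurableSet_eq_fun (hr k k.le_succ) (hr (k + 1) le_rfl)

/-- The Markov property, for functions of the past. -/
lemma lintegral_markov [IsProbabilityMeasure P] {r : ℝ≥0 → Ω → Fin m}
    (hr : ∀ t, Measurable (r t)) {s t : ℝ≥0} {i j : Fin m} {c : ℝ} (hc : 0 ≤ c)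
    (H : ∀ A : Set Ω,
      MeasurableSet[⨆ u : Iic s, MeasurableSpace.comap (r u) inferInstance] A →
        P.real (A ∩ {ω | r s ω = i} ∩ {ω | r (s + t) ω = j}) =
          P.real (A ∩ {ω | r s ω = i}) * c)
    {F : Ω → ℝ≥0∞}
    (hF : Measurable[⨆ u : Iic s, MeasurableSpace.comap (r u) inferInstance] F) :
    ∫⁻ ω in {ω | r s ω = i} ∩ {ω | r (s + t) ω = j}, F ω ∂P =
      ENNReal.ofReal c * ∫⁻ ω in {ω | r s ω = i}, F ω ∂P := by
  have hm : (⨆ u : Iic s, MeasurableSpace.comap (r u) inferInstance) ≤ ‹MeasurableSpace Ω› :=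
    iSup_le fun u ↦ (hr u).comap_le
  -- On the `σ`-algebra of the past, `H` says that one restricted measure is `c` times the other,
  -- hence so are the integrals of `F`.
  rw [← lintegral_trim hm hF, ← lintegral_trim hm hF, ← smul_eq_mul, ← lintegral_smul_measure]
  congr 1
  refine @Measure.ext Ω (⨆ u : Iic s, MeasurableSpace.comap (r u) inferInstance) _ _
    fun A hA ↦ ?_
  rw [trim_measurableSet_eq hm hA, Measure.smul_apply, trim_measurableSet_eq hm hA,
    Measure.restrict_apply (hm A hA), Measure.restrict_apply (hm A hA), ← inter_assoc]
  have h := H A hA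
  rw [measureReal_def, measureReal_def] at h
  rw [← ENNReal.ofReal_toReal (measure_ne_top P (A ∩ {ω | r s ω = i} ∩ {ω | r (s + t) ω = j})), h,
    mul_comm, ENNReal.ofReal_mul hc, ENNReal.ofReal_toReal (measure_ne_top _ _), smul_eq_mul]

/-- Given the past, the next factor has mean at most `1 + m C M Δ`: staying contributes at most `1`,
and each other state at most `M * (C * Δ)`. -/
lemma IsMarkovChain.exists_lintegral_switchWeight_le [IsProbabilityMeasure P]
    {r : ℝ≥0 → Ω → Fin m} {Γ : Matrix (Fin m) (Fin m) ℝ} (hr : IsMarkovChain r Γ P) {M : ℝ}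
    (hM : 0 ≤ M) :
    ∃ C : ℝ, 0 ≤ C ∧ ∀ Δ : ℝ≥0, 0 < Δ → ∀ k : ℕ,
      ∫⁻ ω, switchWeight (ENNReal.ofReal M) Δ (fun t ↦ r t ω) k ∂P ≤
        ENNReal.ofReal (1 + C * Δ) ^ k := by
  obtain ⟨p, hp, hmarkov⟩ := hr.markov
  obtain ⟨C, hC, hpC⟩ := hp.exists_le_mul
  refine ⟨m * (C * M), by positivity, fun Δ hΔ k ↦ ?_⟩
  induction k with
  | zero => simp [switchWeight]
  | succ k ih =>
    set s : ℝ≥0 := k * Δ with hs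
    have hst : ((k + 1 : ℕ) : ℝ≥0) * Δ = s + Δ := by push_cast; rw [hs]; ring
    set F : Ω → ℝ≥0∞ := fun ω ↦ switchWeight (ENNReal.ofReal M) Δ (fun t ↦ r t ω) k with hF
    set c : Fin m → Fin m → ℝ := fun i j ↦ if i = j then 1 else M with hc
    have hc0 (i j : Fin m) : 0 ≤ c i j := by simp only [hc]; split_ifs <;> simp [hM]
    have hFp : Measurable[⨆ u : Iic s, MeasurableSpace.comap (r u) inferInstance] F := by
      let : MeasurableSpace Ω := ⨆ u : Iic s, MeasurableSpace.comap (r u) inferInstance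
      refine measurable_switchWeight _ Δ k fun j hj ↦ measurable_iff_comap_le.2 ?_
      exact le_iSup_of_le (⟨j * Δ, by rw [mem_Iic, hs]; gcongr⟩ : Iic s) le_rfl
    have hFm : Measurable F := measurable_switchWeight _ Δ k fun j _ ↦ hr.measurable _
    have ms (i : Fin m) (t : ℝ≥0) : MeasurableSet {ω | r t ω = i} :=
      hr.measurable t (measurableSet_singleton i)
    have hrow (i : Fin m) : ∑ j, ENNReal.ofReal (c i j) * ENNReal.ofReal (p Δ i j) ≤
        ENNReal.ofReal (1 + m * (C * M) * Δ) := by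
      simp_rw [← ENNReal.ofReal_mul (hc0 i _)]
      rw [← ENNReal.ofReal_sum_of_nonneg fun j _ ↦ mul_nonneg (hc0 i j) (hp.nonneg Δ i j)]
      refine ENNReal.ofReal_le_ofReal ?_
      calc ∑ j, c i j * p Δ i j ≤ ∑ j, (p Δ i j + C * M * Δ) := by
            refine Finset.sum_le_sum fun j _ ↦ ?_
            have hp0 := hp.nonneg Δ i j
            have hΔ0 : (0 : ℝ) ≤ Δ := Δ.2
            simp only [hc]
            split_ifs with hij
            · have : 0 ≤ C * M * Δ := by positivity
              linarith
            · have := mul_le_mul_of_nonneg_left (hpC Δ i j hij hΔ) hM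
              linarith
        _ = _ := by
            rw [Finset.sum_add_distrib, hp.row_sum]
            simp
            ring
    -- Splitting by the present and next states makes the new factor constant on each piece, leaving
    -- only the past weight `F` under the integral.
    have hdec (ω : Ω) : switchWeight (ENNReal.ofReal M) Δ (fun t ↦ r t ω) (k + 1) =
        ∑ i, ∑ j, ENNReal.ofReal (c i j) *
          ({ω | r s ω = i} ∩ {ω | r (s + Δ) ω = j}).indicator F ω := by
      rw [Finset.sum_eq_single (r s ω), Finset.sum_eq_single (r (s + Δ) ω)]
      · rw [indicator_of_mem (by simp)]
        simp only [switchWeight, hst, hc, ← hs, hF]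
        rw [mul_comm]
        split_ifs <;> simp
      · intro j _ hj
        rw [indicator_of_notMem (by simp [hj.symm]), mul_zero]
      · simp
      · intro i _ hi
        refine Finset.sum_eq_zero fun j _ ↦ ?_
        rw [indicator_of_notMem (by simp [hi.symm]), mul_zero]
      · simp
    have hsum : ∑ i, ∫⁻ ω in {ω | r s ω = i}, F ω ∂P = ∫⁻ ω, F ω ∂P := by
      simp_rw [← lintegral_indicator (ms _ s)]
      rw [← lintegral_finsetSum _ fun i _ ↦ hFm.indicator (ms i s)]
      refine lintegral_congr fun ω ↦ ?_
      rw [Finset.sum_eq_single (r s ω)]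
      · simp
      · intro i _ hi
        rw [indicator_of_notMem (by simp [hi.symm])]
      · simp
    calc ∫⁻ ω, switchWeight (ENNReal.ofReal M) Δ (fun t ↦ r t ω) (k + 1) ∂P
        = ∑ i, ∑ j, ENNReal.ofReal (c i j) *
          ∫⁻ ω in {ω | r s ω = i} ∩ {ω | r (s + Δ) ω = j}, F ω ∂P := by
          simp_rw [hdec]
          have mi (i j : Fin m) : Measurable fun ω ↦ ENNReal.ofReal (c i j) *
              ({ω | r s ω = i} ∩ {ω | r (s + Δ) ω = j}).indicator F ω :=
            (hFm.indicator ((ms i s).inter (ms j _))).const_mul _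
          rw [lintegral_finsetSum _ fun i _ ↦ Finset.measurable_fun_sum _ fun j _ ↦ mi i j]
          refine Finset.sum_congr rfl fun i _ ↦ ?_
          rw [lintegral_finsetSum _ fun j _ ↦ mi i j]
          refine Finset.sum_congr rfl fun j _ ↦ ?_
          rw [lintegral_const_mul' _ _ ENNReal.ofReal_ne_top,
            lintegral_indicator ((ms i s).inter (ms j _))]
      _ = ∑ i, (∑ j, ENNReal.ofReal (c i j) * ENNReal.ofReal (p Δ i j)) *
          ∫⁻ ω in {ω | r s ω = i}, F ω ∂P := by
          refine Finset.sum_congr rfl fun i _ ↦ ?_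
          rw [Finset.sum_mul]
          refine Finset.sum_congr rfl fun j _ ↦ ?_
          rw [lintegral_markov hr.measurable (hp.nonneg Δ i j)
            (fun A hA ↦ hmarkov s Δ A hA i j) hFp, mul_assoc]
      _ ≤ ∑ i, ENNReal.ofReal (1 + m * (C * M) * Δ) * ∫⁻ ω in {ω | r s ω = i}, F ω ∂P := by
          gcongr with i _
          exact hrow i
      _ = ENNReal.ofReal (1 + m * (C * M) * Δ) * ∫⁻ ω, F ω ∂P := by
          rw [← Finset.mul_sum, hsum]
      _ ≤ _ := by
          rw [pow_succ']
          gcongr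

end TruncatedEM

/-! ### Lyapunov bounds along the scheme -/

namespace TruncatedEM

variable {Ω : Type*} [MeasurableSpace Ω] {P : Measure Ω} {n d m : ℕ}
  {f : Vec n → Fin m → Vec n} {g : Vec n → Fin m → Matrix (Fin n) (Fin d) ℝ}
  {φ : Fin m → ℝ → ℝ} {h : ℝ → ℝ} {x₀ : Vec n}

/-- The Lyapunov function `(1 + xᵀ Q x) ^ q`. -/
noncomputable def lyapunov (Q : Matrix (Fin n) (Fin n) ℝ) (q : ℝ) (x : Vec n) : ℝ≥0∞ :=
  ENNReal.ofReal ((1 + quad Q x x) ^ q)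

lemma measurable_lyapunov (Q : Matrix (Fin n) (Fin n) ℝ) (q : ℝ) :
    Measurable (lyapunov Q q) := by
  have := (continuous_quad Q).measurable
  unfold lyapunov
  fun_prop

lemma lyapunov_truncate_le {Q : Matrix (Fin n) (Fin n) ℝ} (hQ : Q.PosDef) {q : ℝ} (hq : 0 ≤ q)
    (ρ : ℝ≥0∞) (x : Vec n) : lyapunov Q q (truncate ρ x) ≤ lyapunov Q q x := by
  have h0 := quad_self_nonneg hQ (truncate ρ x)
  have h1 := quad_truncate_le hQ ρ x
  exact ENNReal.ofReal_le_ofReal (Real.rpow_le_rpow (by linarith) (by linarith) hq)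

/-- The cost of a switch: every `1 + xᵀ Q_i x` is comparable to `(1 + |x|)²`, and summing over the
finite state space makes the constant uniform. -/
lemma lyapunov_le_mul_lyapunov {Q : Fin m → Matrix (Fin n) (Fin n) ℝ} (hQ : ∀ i, (Q i).PosDef)
    {q : ℝ} (hq : 0 ≤ q) {κ : ℝ} (hκ0 : 0 ≤ κ)
    (hκ : ∀ i x, (1 + ‖x‖) ^ 2 ≤ κ * (1 + quad (Q i) x x)) (i j : Fin m) (x : Vec n) :
    lyapunov (Q j) q x ≤
      ENNReal.ofReal (((∑ i, (1 + ‖Matrix.toEuclideanCLM (𝕜 := ℝ) (Q i)‖)) * κ) ^ q) *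
        lyapunov (Q i) q x := by
  set b := ∑ i, (1 + ‖Matrix.toEuclideanCLM (𝕜 := ℝ) (Q i)‖) with hb
  have hb0 : 0 ≤ b := Finset.sum_nonneg fun i _ ↦ by positivity
  have hi := quad_self_nonneg (hQ i) x
  have hj := quad_self_nonneg (hQ j) x
  rw [lyapunov, lyapunov, ← ENNReal.ofReal_mul (by positivity),
    ← Real.mul_rpow (by positivity) (by linarith)]
  refine ENNReal.ofReal_le_ofReal (Real.rpow_le_rpow (by linarith) ?_ hq)
  have h1 := (le_abs_self _).trans (abs_quad_le (Q j) x x)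
  have h2 : 1 + ‖Matrix.toEuclideanCLM (𝕜 := ℝ) (Q j)‖ ≤ b := Finset.single_le_sum
    (f := fun i ↦ 1 + ‖Matrix.toEuclideanCLM (𝕜 := ℝ) (Q i)‖)
    (fun i _ ↦ by positivity) (Finset.mem_univ j)
  have hβ0 : 0 ≤ ‖Matrix.toEuclideanCLM (𝕜 := ℝ) (Q j)‖ := norm_nonneg _
  generalize ‖Matrix.toEuclideanCLM (𝕜 := ℝ) (Q j)‖ = β at h1 h2 hβ0
  have h3 : 1 + β * (‖x‖ * ‖x‖) ≤ (1 + β) * (1 + ‖x‖) ^ 2 := by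
    have : 0 ≤ β * (1 + 2 * ‖x‖) + 2 * ‖x‖ + ‖x‖ * ‖x‖ := by positivity
    linarith
  calc 1 + quad (Q j) x x ≤ (1 + β) * (1 + ‖x‖) ^ 2 := by linarith
    _ ≤ b * (κ * (1 + quad (Q i) x x)) := by
        have := hκ i x
        gcongr
    _ = _ := by ring

lemma ofReal_norm_rpow_le {Q : Matrix (Fin n) (Fin n) ℝ} (hQ : Q.PosDef) {p pbar : ℝ}
    (hpbar : 0 < pbar) (hp : 0 < p) (hppbar : p ≤ pbar) {κ : ℝ} (hκ0 : 0 ≤ κ)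
    (hκ : ∀ x, (1 + ‖x‖) ^ 2 ≤ κ * (1 + quad Q x x)) (x : Vec n) :
    ENNReal.ofReal (‖x‖ ^ p) ≤
      1 + ENNReal.ofReal (κ ^ (pbar / 2)) * lyapunov Q (pbar / 2) x := by
  have hx := norm_nonneg x
  have hi := quad_self_nonneg hQ x
  have hV : 0 ≤ (1 + quad Q x x) ^ (pbar / 2) := Real.rpow_nonneg (by linarith) _
  rw [lyapunov, ← ENNReal.ofReal_mul (by positivity), ← ENNReal.ofReal_one,
    ← ENNReal.ofReal_add zero_le_one (mul_nonneg (by positivity) hV)]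
  refine ENNReal.ofReal_le_ofReal ?_
  have h1 : ‖x‖ ^ pbar ≤ κ ^ (pbar / 2) * (1 + quad Q x x) ^ (pbar / 2) := by
    rw [← Real.mul_rpow hκ0 (by linarith)]
    calc ‖x‖ ^ pbar = (‖x‖ ^ 2) ^ (pbar / 2) := by
          rw [← Real.rpow_natCast, ← Real.rpow_mul hx]
          norm_num [mul_div_cancel₀]
      _ ≤ _ := Real.rpow_le_rpow (by positivity)
          ((pow_le_pow_left₀ hx (by linarith) 2).trans (hκ x)) (by positivity)
  rcases le_total ‖x‖ 1 with hx1 | hx1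
  · have h2 := Real.rpow_le_one hx hx1 hp.le
    have h3 := Real.rpow_nonneg hx pbar
    linarith
  · have h2 := Real.rpow_le_rpow_of_exponent_le hx1 hppbar
    linarith

/-- The scheme sees `ω` only through the two driving paths, so it may be moved to path space or to a
frozen switching path. -/
lemma preScheme_congr {Ω Ω' : Type*} {B : ℝ≥0 → Ω → Vec d} {B' : ℝ≥0 → Ω' → Vec d}
    {r : ℝ≥0 → Ω → Fin m} {r' : ℝ≥0 → Ω' → Fin m} {ω : Ω} {ω' : Ω'} (hB : ∀ t, B t ω = B' t ω')
    (hr : ∀ t, r t ω = r' t ω') (Δ : ℝ≥0) (k : ℕ) :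
    preScheme f g φ h x₀ B r Δ k ω = preScheme f g φ h x₀ B' r' Δ k ω' := by
  induction k with
  | zero => rfl
  | succ k ih => simp only [preScheme, ih, hB, hr]

lemma scheme_congr {Ω Ω' : Type*} {B : ℝ≥0 → Ω → Vec d} {B' : ℝ≥0 → Ω' → Vec d}
    {r : ℝ≥0 → Ω → Fin m} {r' : ℝ≥0 → Ω' → Fin m} {ω : Ω} {ω' : Ω'} (hB : ∀ t, B t ω = B' t ω')
    (hr : ∀ t, r t ω = r' t ω') (Δ : ℝ≥0) (k : ℕ) :
    scheme f g φ h x₀ B r Δ k ω = scheme f g φ h x₀ B' r' Δ k ω' := by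
  simp only [scheme, preScheme_congr hB hr, hr]

/-- The Lyapunov bound for the scheme driven by a deterministic switching path. -/
lemma lintegral_lyapunov_scheme_path_le [IsProbabilityMeasure P] {B : ℝ≥0 → Ω → Vec d}
    (hB : IsBrownianMotion B P) (hfg : LocallyLipschitzCoeff f g)
    {Q : Fin m → Matrix (Fin n) (Fin n) ℝ} (hQ : ∀ i, (Q i).PosDef) {q : ℝ} (hq : 0 ≤ q)
    {M : ℝ≥0∞} (hM : ∀ i j x, lyapunov (Q j) q x ≤ M * lyapunov (Q i) q x)
    {Δ : ℝ≥0} (hΔ : 0 < Δ) {a : ℝ≥0∞}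
    (hstep : ∀ i x y, y = truncate (growthInv (φ i) (h Δ)) x →
      ∫⁻ z, lyapunov (Q i) q (y + (Δ : ℝ) • f y i + colMul (g y i) (√(Δ : ℝ) • z))
        ∂(stdGaussian (Vec d)) ≤ a * lyapunov (Q i) q y)
    {V₀ : ℝ≥0∞} (hV₀ : ∀ i, lyapunov (Q i) q x₀ ≤ V₀) (ρ : ℝ≥0 → Fin m) (k : ℕ) :
    ∫⁻ ω, lyapunov (Q (ρ (k * Δ))) q (scheme f g φ h x₀ B (fun t _ ↦ ρ t) Δ k ω) ∂P ≤
      a ^ k * switchWeight M Δ ρ k * V₀ := by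
  induction k with
  | zero =>
    refine (lintegral_mono fun ω ↦ (lyapunov_truncate_le (hQ _) hq _ _).trans (hV₀ _)).trans ?_
    simp [switchWeight]
  | succ k ih =>
    set i := ρ (k * Δ) with hi
    set j := ρ ((k + 1 : ℕ) * Δ) with hj
    set Y : Ω → Vec n := scheme f g φ h x₀ B (fun t _ ↦ ρ t) Δ k with hY
    set Z : Ω → Vec d := fun ω ↦ (√(Δ : ℝ))⁻¹ • (B ((k + 1 : ℕ) * Δ) ω - B (k * Δ) ω) with hZ
    set F : Vec n × Vec d → ℝ≥0∞ := fun p ↦ lyapunov (Q i) q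
      (p.1 + (Δ : ℝ) • f p.1 i + colMul (g p.1 i) (√(Δ : ℝ) • p.2)) with hF
    have hs0 : √(Δ : ℝ) ≠ 0 := by
      have : (0 : ℝ) < Δ := hΔ
      positivity
    have hpre (ω : Ω) : lyapunov (Q i) q
        (preScheme f g φ h x₀ B (fun t _ ↦ ρ t) Δ (k + 1) ω) = F (Y ω, Z ω) := by
      simp only [hF, hZ, smul_smul, mul_inv_cancel₀ hs0, one_smul]
      rfl
    have hswitch (x : Vec n) : lyapunov (Q j) q x ≤ (if i = j then 1 else M) *
        lyapunov (Q i) q x := by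
      split_ifs with hij
      · rw [hij, one_mul]
      · exact hM i j x
    have mB (l : ℕ) : Measurable fun ω ↦ B ((l + 1 : ℕ) * Δ) ω - B (l * Δ) ω :=
      (hB.measurable _).sub (hB.measurable _)
    have mY : Measurable Y := measurable_scheme hfg k (fun l _ ↦ mB l) fun l _ ↦ measurable_const
    have mZ : Measurable Z := (mB k).const_smul (√(Δ : ℝ))⁻¹
    have mF : Measurable F := by
      refine (measurable_lyapunov (Q i) q).comp ((continuous_step hfg i Δ).comp
        (f := fun p : Vec n × Vec d ↦ (p.1, √(Δ : ℝ) • p.2)) (by fun_prop)).measurable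
    -- With a deterministic switching path, `Y` is a function of past Brownian increments alone,
    -- hence independent of the next one.
    have hYpast : Measurable[pastIncrements B Δ k] Y :=
      @measurable_scheme _ _ _ _ _ _ (pastIncrements B Δ k) _ _ _ _ _ _ hfg k
        (fun l hl ↦ measurable_increment_pastIncrements B Δ hl)
        fun l _ ↦ @measurable_const _ _ _ (pastIncrements B Δ k) _
    have hind : IndepFun Y Z P := (hB.indepFun_increment Δ k hYpast).comp
      (φ := id) (ψ := fun z : Vec d ↦ (√(Δ : ℝ))⁻¹ • z) measurable_id (by fun_prop)
    -- Pathwise, the new truncation is dropped and the change from `Q i` to `Q j` is paid for; then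
    -- independence lets `Z` be averaged with `Y` fixed, which is the one-step bound.
    calc ∫⁻ ω, lyapunov (Q j) q (scheme f g φ h x₀ B (fun t _ ↦ ρ t) Δ (k + 1) ω) ∂P
        ≤ ∫⁻ ω, (if i = j then 1 else M) * F (Y ω, Z ω) ∂P := by
          refine lintegral_mono fun ω ↦ ?_
          rw [← hpre]
          exact (lyapunov_truncate_le (hQ _) hq _ _).trans (hswitch _)
      _ = (if i = j then 1 else M) * ∫⁻ ω, F (Y ω, Z ω) ∂P :=
          lintegral_const_mul _ (mF.comp (mY.prodMk mZ))
      _ = (if i = j then 1 else M) * ∫⁻ y, ∫⁻ z, F (y, z) ∂(stdGaussian (Vec d)) ∂(P.map Y) := by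
          rw [← lintegral_map (f := F) mF (mY.prodMk mZ),
            hind.map_prod_eq_prod_map_map mY.aemeasurable mZ.aemeasurable, hB.map_increment hΔ k,
            lintegral_prod _ mF.aemeasurable]
      _ = (if i = j then 1 else M) * ∫⁻ ω, ∫⁻ z, F (Y ω, z) ∂(stdGaussian (Vec d)) ∂P := by
          rw [lintegral_map mF.lintegral_prod_right' mY]
      _ ≤ (if i = j then 1 else M) * ∫⁻ ω, a * lyapunov (Q i) q (Y ω) ∂P := by
          gcongr with ω
          exact hstep i _ _ rfl
      _ = (if i = j then 1 else M) * (a * ∫⁻ ω, lyapunov (Q i) q (Y ω) ∂P) := by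
          rw [lintegral_const_mul a (f := fun ω ↦ lyapunov (Q i) q (Y ω))
            ((measurable_lyapunov _ q).comp mY)]
      _ ≤ (if i = j then 1 else M) * (a * (a ^ k * switchWeight M Δ ρ k * V₀)) := by gcongr
      _ = _ := by
          simp only [switchWeight, ← hi, ← hj]
          ring

/-- The Lyapunov bound for the scheme with Markovian switching, by conditioning on the path of the
chain. -/
lemma lintegral_lyapunov_scheme_le [IsProbabilityMeasure P] {B : ℝ≥0 → Ω → Vec d}
    (hB : IsBrownianMotion B P) {r : ℝ≥0 → Ω → Fin m} (hr : ∀ t, Measurable (r t))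
    (hindep : IndepFun (fun ω t ↦ r t ω) (fun ω t ↦ B t ω) P)
    (hfg : LocallyLipschitzCoeff f g)
    {Q : Fin m → Matrix (Fin n) (Fin n) ℝ} (hQ : ∀ i, (Q i).PosDef) {q : ℝ} (hq : 0 ≤ q)
    {M : ℝ≥0∞} (hM : ∀ i j x, lyapunov (Q j) q x ≤ M * lyapunov (Q i) q x)
    {Δ : ℝ≥0} (hΔ : 0 < Δ) {a : ℝ≥0∞}
    (hstep : ∀ i x y, y = truncate (growthInv (φ i) (h Δ)) x →
      ∫⁻ z, lyapunov (Q i) q (y + (Δ : ℝ) • f y i + colMul (g y i) (√(Δ : ℝ) • z))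
        ∂(stdGaussian (Vec d)) ≤ a * lyapunov (Q i) q y)
    {V₀ : ℝ≥0∞} (hV₀ : ∀ i, lyapunov (Q i) q x₀ ≤ V₀) (k : ℕ) :
    ∫⁻ ω, lyapunov (Q (r (k * Δ) ω)) q (scheme f g φ h x₀ B r Δ k ω) ∂P ≤
      a ^ k * V₀ * ∫⁻ ω, switchWeight M Δ (fun t ↦ r t ω) k ∂P := by
  -- Canonical processes on path space, where the joint law of chain and Brownian motion is a
  -- product and Tonelli's theorem applies.
  set B' : ℝ≥0 → (ℝ≥0 → Fin m) × (ℝ≥0 → Vec d) → Vec d := fun t p ↦ p.2 t with hB'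
  set r' : ℝ≥0 → (ℝ≥0 → Fin m) × (ℝ≥0 → Vec d) → Fin m := fun t p ↦ p.1 t with hr'
  set G : (ℝ≥0 → Fin m) × (ℝ≥0 → Vec d) → ℝ≥0∞ := fun p ↦
    lyapunov (Q (p.1 (k * Δ))) q (scheme f g φ h x₀ B' r' Δ k p) with hG
  have mB' (t : ℝ≥0) : Measurable (B' t) := (measurable_pi_apply t).comp measurable_snd
  have mr' (t : ℝ≥0) : Measurable (r' t) := (measurable_pi_apply t).comp measurable_fst
  have mS : Measurable (scheme f g φ h x₀ B' r' Δ k) :=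
    measurable_scheme hfg k (fun _ _ ↦ (mB' _).sub (mB' _)) fun _ _ ↦ mr' _
  have mG : Measurable G := measurable_apply_of_countable
    (F := fun i x ↦ lyapunov (Q i) q x) (fun i ↦ measurable_lyapunov (Q i) q) (mr' (k * Δ)) mS
  have mr : Measurable fun ω t ↦ r t ω := measurable_pi_lambda _ hr
  have mB : Measurable fun ω t ↦ B t ω := measurable_pi_lambda _ hB.measurable
  have hpath (ρ : ℝ≥0 → Fin m) : ∫⁻ b, G (ρ, b) ∂(P.map fun ω t ↦ B t ω) ≤
      a ^ k * switchWeight M Δ ρ k * V₀ := by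
    rw [lintegral_map (f := fun b ↦ G (ρ, b)) (mG.comp measurable_prodMk_left) mB]
    refine le_trans (le_of_eq (lintegral_congr fun ω ↦ ?_))
      (lintegral_lyapunov_scheme_path_le hB hfg hQ hq hM hΔ hstep hV₀ ρ k)
    simp only [hG]
    rw [scheme_congr (B := B') (r := r') (B' := B) (r' := fun t _ ↦ ρ t) (ω' := ω)
      (fun t ↦ rfl) (fun t ↦ rfl)]
  have mw : Measurable fun ρ : ℝ≥0 → Fin m ↦ switchWeight M Δ ρ k :=
    measurable_switchWeight M Δ (r := fun t (ρ : ℝ≥0 → Fin m) ↦ ρ t) k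
      fun _ _ ↦ measurable_pi_apply _
  calc ∫⁻ ω, lyapunov (Q (r (k * Δ) ω)) q (scheme f g φ h x₀ B r Δ k ω) ∂P
      = ∫⁻ ω, G (fun t ↦ r t ω, fun t ↦ B t ω) ∂P := by
        refine lintegral_congr fun ω ↦ ?_
        simp only [hG]
        rw [scheme_congr (B := B) (r := r) (B' := B') (r' := r')
          (ω' := (fun t ↦ r t ω, fun t ↦ B t ω)) (fun t ↦ rfl) (fun t ↦ rfl)]
    _ = ∫⁻ ρ, ∫⁻ b, G (ρ, b) ∂(P.map fun ω t ↦ B t ω) ∂(P.map fun ω t ↦ r t ω) := by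
        rw [← lintegral_map (f := G) mG (mr.prodMk mB),
          hindep.map_prod_eq_prod_map_map mr.aemeasurable mB.aemeasurable,
          lintegral_prod _ mG.aemeasurable]
    _ ≤ ∫⁻ ρ, a ^ k * V₀ * switchWeight M Δ ρ k ∂(P.map fun ω t ↦ r t ω) := by
        refine lintegral_mono fun ρ ↦ (hpath ρ).trans (le_of_eq (by ring))
    _ = _ := by
        rw [lintegral_const_mul _ mw, lintegral_map mw mr]

end TruncatedEM

/-! ### Assembly of the moment bound -/

open TruncatedEM in
theorem theorem3p2 {Ω : Type*} [MeasurableSpace Ω] (P : Measure Ω) [IsProbabilityMeasure P]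
    {n d m : ℕ}
    (B : ℝ≥0 → Ω → TruncatedEM.Vec d) (hB : TruncatedEM.IsBrownianMotion B P)
    (Γ : Matrix (Fin m) (Fin m) ℝ) (hΓ : TruncatedEM.IsRateMatrix Γ)
    (r : ℝ≥0 → Ω → Fin m) (hr : TruncatedEM.IsMarkovChain r Γ P)
    (hindep : IndepFun (fun ω t ↦ r t ω) (fun ω t ↦ B t ω) P)
    (x₀ : TruncatedEM.Vec n) (ℓ : Fin m) (hℓ : ∀ᵐ ω ∂P, r 0 ω = ℓ)
    (f : TruncatedEM.Vec n → Fin m → TruncatedEM.Vec n)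
    (g : TruncatedEM.Vec n → Fin m → Matrix (Fin n) (Fin d) ℝ)
    (hfg : TruncatedEM.LocallyLipschitzCoeff f g)
    (pbar : ℝ) (hA : TruncatedEM.GrowthAssumption f g pbar)
    (φ : Fin m → ℝ → ℝ) (hφ : ∀ i, TruncatedEM.IsGrowthBound f g i (φ i))
    (K : ℝ) (hK : 0 < K) (h : ℝ → ℝ) (hh : TruncatedEM.IsStepFunction φ x₀ h K)
    (p : ℝ) (hp : p ∈ Ioc 0 pbar) (T : ℝ) (hT : 0 < T) :
    ∃ C : ℝ, 0 < C ∧ ∀ Δ : ℝ≥0, 0 < Δ → Δ ≤ 1 → ∀ k : ℕ, (k : ℝ) * Δ ≤ T →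
      Integrable (fun ω ↦ ‖TruncatedEM.scheme f g φ h x₀ B r Δ k ω‖ ^ p) P ∧
        ∫ ω, ‖TruncatedEM.scheme f g φ h x₀ B r Δ k ω‖ ^ p ∂P ≤ C := by
  obtain ⟨hp0, hppbar⟩ := hp
  set q : ℝ := pbar / 2 with hq
  have hq0 : 0 < q := half_pos hA.1
  choose Q A hQ hQA using hA.exists_bound hfg
  choose κ hκ0 hκ using fun i ↦ exists_one_add_norm_sq_le_quad (hQ i)
  choose c hc0 hc using fun i ↦ lintegral_step_le (hQ i) hq0 hK.le (A i) d
  -- Sums over the finite state space serve as constants uniform in the state.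
  set κ' := ∑ i, κ i with hκ'
  have hκ'0 : 0 ≤ κ' := Finset.sum_nonneg fun i _ ↦ (hκ0 i).le
  have hκle (i : Fin m) (x : Vec n) : (1 + ‖x‖) ^ 2 ≤ κ' * (1 + quad (Q i) x x) := by
    refine (hκ i x).trans (mul_le_mul_of_nonneg_right ?_
      (by linarith [quad_self_nonneg (hQ i) x]))
    exact Finset.single_le_sum (f := κ) (fun i _ ↦ (hκ0 i).le) (Finset.mem_univ i)
  set C₁ := ∑ i, c i with hC₁
  have hC₁0 : 0 ≤ C₁ := Finset.sum_nonneg fun i _ ↦ hc0 i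
  have hcle (i : Fin m) : c i ≤ C₁ :=
    Finset.single_le_sum (f := c) (fun i _ ↦ hc0 i) (Finset.mem_univ i)
  set b := ∑ i, (1 + ‖Matrix.toEuclideanCLM (𝕜 := ℝ) (Q i)‖) with hb
  have hb0 : 0 ≤ b := Finset.sum_nonneg fun i _ ↦ by positivity
  set M : ℝ := (b * κ') ^ q with hM
  have hM0 : 0 ≤ M := by positivity
  have hMle := lyapunov_le_mul_lyapunov hQ hq0.le hκ'0 hκle
  obtain ⟨C₂, hC₂0, hC₂⟩ := hr.exists_lintegral_switchWeight_le hM0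
  set V₀ : ℝ := ∑ i, (1 + quad (Q i) x₀ x₀) ^ q with hV₀
  have hVnn (i : Fin m) (x : Vec n) : 0 ≤ (1 + quad (Q i) x x) ^ q :=
    Real.rpow_nonneg (by linarith [quad_self_nonneg (hQ i) x]) q
  have hV₀0 : 0 ≤ V₀ := Finset.sum_nonneg fun i _ ↦ hVnn i x₀
  have hV₀le (i : Fin m) : lyapunov (Q i) q x₀ ≤ ENNReal.ofReal V₀ :=
    ENNReal.ofReal_le_ofReal (Finset.single_le_sum
      (f := fun i ↦ (1 + quad (Q i) x₀ x₀) ^ q) (fun i _ ↦ hVnn i x₀) (Finset.mem_univ i))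
  set E : ℝ := Real.exp (C₁ * T) * V₀ * Real.exp (C₂ * T) with hE
  have hE0 : 0 ≤ E := by positivity
  -- The `1` covers `‖Y‖ ≤ 1`, where the exponent `p` cannot be raised to `pbar`; `E` bounds the
  -- mean of the Lyapunov function.
  refine ⟨1 + κ' ^ q * E, by positivity, fun Δ hΔ hΔ1 k hk ↦ ?_⟩
  have hΔ' : (Δ : ℝ) ∈ Ioc (0 : ℝ) 1 := ⟨hΔ, hΔ1⟩
  have hΔ0 : (0 : ℝ) ≤ Δ := Δ.2
  have hstep (i : Fin m) (x y : Vec n) : y = truncate (growthInv (φ i) (h Δ)) x →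
      ∫⁻ z, lyapunov (Q i) q (y + (Δ : ℝ) • f y i + colMul (g y i) (√(Δ : ℝ) • z))
        ∂(stdGaussian (Vec d)) ≤ ENNReal.ofReal (1 + C₁ * Δ) * lyapunov (Q i) q y := by
    intro hy
    have hH : φ i 1 ≤ h Δ :=
      ((hφ i).apply_one_le (le_max_right ‖x₀‖ 1)).trans (hh.lower Δ hΔ' i)
    obtain ⟨hf, hg⟩ := (hφ i).norm_le hH x
    rw [← hy] at hf hg
    have hup : √(Δ : ℝ) * h Δ ≤ K := by
      rw [Real.sqrt_eq_rpow]; exact hh.upper Δ hΔ'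
    refine (hc i Δ (h Δ) hΔ0 hΔ1 hup y (f y i) (g y i) hf hg ?_).trans ?_
    · have := hQA i y
      rw [psi] at this
      rw [hq, mul_div_cancel₀ _ two_ne_zero]
      exact this
    · rw [lyapunov, ← ENNReal.ofReal_mul (by positivity)]
      refine ENNReal.ofReal_le_ofReal (mul_le_mul_of_nonneg_right ?_ (hVnn i y))
      have := mul_le_mul_of_nonneg_right (hcle i) hΔ0
      linarith
  -- From `1 + x ≤ exp x` and `k * Δ ≤ T`; this removes the dependence on `k` and `Δ`.
  have hpow {C : ℝ} (hC : 0 ≤ C) : (1 + C * (Δ : ℝ)) ^ k ≤ Real.exp (C * T) := by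
    calc (1 + C * (Δ : ℝ)) ^ k ≤ (Real.exp (C * Δ)) ^ k := by
          refine pow_le_pow_left₀ (by positivity) ?_ k
          linarith [Real.add_one_le_exp (C * (Δ : ℝ))]
      _ = Real.exp (C * (k * Δ)) := by rw [← Real.exp_nat_mul]; ring_nf
      _ ≤ _ := Real.exp_le_exp.2 (mul_le_mul_of_nonneg_left hk hC)
  have hmain : ∫⁻ ω, lyapunov (Q (r (k * Δ) ω)) q (scheme f g φ h x₀ B r Δ k ω) ∂P ≤
      ENNReal.ofReal E := by
    refine (lintegral_lyapunov_scheme_le hB hr.measurable hindep hfg hQ hq0.le hMle hΔ hstep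
      hV₀le k).trans ((mul_le_mul_right (hC₂ Δ hΔ k) _).trans ?_)
    rw [← ENNReal.ofReal_pow (by positivity), ← ENNReal.ofReal_pow (by positivity),
      ← ENNReal.ofReal_mul (by positivity), ← ENNReal.ofReal_mul (by positivity)]
    refine ENNReal.ofReal_le_ofReal ?_
    have h1 := hpow hC₁0
    have h2 := hpow hC₂0
    rw [hE]
    gcongr
  have mY : Measurable (scheme f g φ h x₀ B r Δ k) :=
    measurable_scheme hfg k (fun _ _ ↦ (hB.measurable _).sub (hB.measurable _))
      fun _ _ ↦ hr.measurable _
  have mYp : Measurable fun ω ↦ ‖scheme f g φ h x₀ B r Δ k ω‖ ^ p := by fun_prop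
  have hfin : ∫⁻ ω, ENNReal.ofReal (‖scheme f g φ h x₀ B r Δ k ω‖ ^ p) ∂P ≤
      ENNReal.ofReal (1 + κ' ^ q * E) := by
    calc _ ≤ ∫⁻ ω, (1 + ENNReal.ofReal (κ' ^ q) *
          lyapunov (Q (r (k * Δ) ω)) q (scheme f g φ h x₀ B r Δ k ω)) ∂P :=
          lintegral_mono fun ω ↦ ofReal_norm_rpow_le (hQ _) hA.1 hp0 hppbar hκ'0 (hκle _) _
      _ = 1 + ENNReal.ofReal (κ' ^ q) *
          ∫⁻ ω, lyapunov (Q (r (k * Δ) ω)) q (scheme f g φ h x₀ B r Δ k ω) ∂P := by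
          rw [lintegral_add_left measurable_const, lintegral_const_mul' _ _ ENNReal.ofReal_ne_top]
          simp
      _ ≤ 1 + ENNReal.ofReal (κ' ^ q) * ENNReal.ofReal E := by gcongr
      _ = _ := by
          rw [← ENNReal.ofReal_mul (by positivity), ← ENNReal.ofReal_one,
            ← ENNReal.ofReal_add zero_le_one (by positivity)]
  have hnn : 0 ≤ᵐ[P] fun ω ↦ ‖scheme f g φ h x₀ B r Δ k ω‖ ^ p :=
    ae_of_all _ fun ω ↦ Real.rpow_nonneg (norm_nonneg _) p
  refine ⟨⟨mYp.aestronglyMeasurable, ?_⟩, ?_⟩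
  · rw [hasFiniteIntegral_iff_ofReal hnn]
    exact hfin.trans_lt ENNReal.ofReal_lt_top
  · rw [integral_eq_lintegral_of_nonneg_ae hnn mYp.aestronglyMeasurable]
    exact ENNReal.toReal_le_of_le_ofReal (by positivity) hfin
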